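/- Let $\mathbb{B}=\{z\in\mathbb{C}\mid 0<|z|\le 1,\ \frac1z=1\text{ or }|1-\frac1z|\ge 1\}$ (equivalently, $0<|z|\le 1$, and $z=1$ or $\mathrm{Re}(z)\le\frac12$). If $z\in\mathbb{B}\setminus\{1\}$, then $\frac{z}{z-1}\in\mathbb{B}\setminus\{1\}$. Let $\mathcal{A}=\mathbb{Q}\langle x,e_z\ (z\in\mathbb{B})\rangle$ be the non-commutative polynomial algebra, and let $$\mathcal{A}^0=\mathbb{Q}\oplus\bigoplus_{\substack{z\in\mathbb{B}\\ \mathrm{Re}(z)\ne\frac12,\ |z|\neq1}}\mathbb{Q}e_z\oplus\bigoplus_{\substack{z\in\mathbb{B}\\ \mathrm{Re}(z)\neq\frac12}}e_z\mathcal{A}x\oplus\bigoplus_{\substack{z,z'\in\mathbb{B}\\ \mathrm{Re}(z)\neq\frac12,\ |z'|\neq1}}e_z\mathcal{A}e_{z'} .$$ For positive integers $k_1,\dots,k_r$ and complex numbers $z_1,\dots,z_r$ put $$\mathrm{Li}_{k_1,\dots,k_r}(z_1,\dots,z_r)=\sum_{0=m_0<m_1<\cdots<m_r}\ \prod_{i=1}^r\frac{z_i^{m_i-m_{i-1}}}{m_i^{k_i}}$$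 (equal to $1$ for $r=0$). For every word $e_{z_1}x^{k_1-1}\cdots e_{z_r}x^{k_r-1}$ of $\mathcal{A}^0$ this series converges absolutely; let $L:\mathcal{A}^0\to\mathbb{C}$ be the $\mathbb{Q}$-linear map that sends each such word to $\mathrm{Li}_{k_1,\dots,k_r}(z_1,\dots,z_r)$, and extend it to $\mathcal{A}^0[[t]]\to\mathbb{C}[[t]]$ by $L(\sum_i w_it^i)=\sum_i L(w_i)t^i$, where $\mathcal{A}^0[[t]]$ is the set of power series in $\mathcal{A}[[t]]$ all of whose coefficients lie in $\mathcal{A}^0$. Let $\sigma$ be the automorphism and $\tau$ the anti-automorphism of $\mathcal{A}[[t]]$ that satisfy $\sigma(\sum_i w_it^i)=\sum_i\sigma(w_i)t^i$ and $\tau(\sum_i w_it^i)=\sum_i\tau(w_i)t^i$ for $w_i\in\mathcal{A}$, and are given on the generators by $$\sigma(x)=x,\qquad \sigma(e_z)=e_z(1-xt)^{-1}\quad(z\in\mathbb{B}),$$ $$\tau(x)=e_1,\qquad \tau(e_1)=x,\qquad \tau(e_z)=-e_{\frac{z}{z-1}}\bigl(1-e_{\frac{z}{z-1}}t\bigr)^{-1}\quad(z\in\mathbb{B}\setminus\{1\}).$$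 Then for every $w\in\mathcal{A}^0[[t]]$, the series $\sigma(w)$ and $\sigma(\tau(w))$ lie in $\mathcal{A}^0[[t]]$, and $$L(\sigma(w))=L(\sigma(\tau(w))).$$ -/

import Mathlib

open scoped PowerSeries

namespace HoffmanMPL

noncomputable section

/-! ### Shuffle-type multiple polylogarithms -/

/-- The set `S_r` of integer tuples `0 = m_0 < m_1 < ⋯ < m_r`. -/
def Chain (r : ℕ) : Type := {m : Fin (r + 1) → ℕ // m 0 = 0 ∧ StrictMono m}

/-- The summand `∏_{i=1}^r z_i ^ (m_i - m_{i-1}) / m_i ^ k_i`. -/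
def liTerm {r : ℕ} (k : Fin r → ℕ+) (z : Fin r → ℂ) (m : Chain r) : ℂ :=
  ∏ i : Fin r, z i ^ (m.1 i.succ - m.1 i.castSucc) / (m.1 i.succ : ℂ) ^ (k i : ℕ)

/-- The shuffle-type multiple polylogarithm `Li_k(z_1, …, z_r)`. -/
def shuffleLi {r : ℕ} (k : Fin r → ℕ+) (z : Fin r → ℂ) : ℂ :=
  ∑' m : Chain r, liTerm k z m

/-! ### The letters and the algebra -/

/-- The set `𝔹` of the `z` in the punctured closed unit disk with `1/z = 1` or `|1 - 1/z| ≥ 1`. -/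
def BSet : Set ℂ := {z | (‖z‖ ≤ 1 ∧ z ≠ 0) ∧ (1 / z = 1 ∨ 1 ≤ ‖1 - 1 / z‖)}

theorem norm_le_norm_sub_one_iff (z : ℂ) : ‖z‖ ≤ ‖z - 1‖ ↔ z.re ≤ 1 / 2 := by
  rw [← sq_le_sq₀ (norm_nonneg _) (norm_nonneg _), ← Complex.normSq_eq_norm_sq,
    ← Complex.normSq_eq_norm_sq, Complex.normSq_apply, Complex.normSq_apply]
  simp only [Complex.sub_re, Complex.one_re, Complex.sub_im, Complex.one_im, sub_zero]
  constructor <;> intro h <;> nlinarith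

theorem one_le_norm_iff {z : ℂ} (hz : z ≠ 0) : 1 ≤ ‖1 - 1 / z‖ ↔ ‖z‖ ≤ ‖z - 1‖ := by
  have h : (1 : ℂ) - 1 / z = (z - 1) / z := by field_simp
  rw [h, norm_div, le_div_iff₀ (norm_pos_iff.2 hz), one_mul]

theorem mem_BSet_iff (z : ℂ) :
    z ∈ BSet ↔ z ≠ 0 ∧ ‖z‖ ≤ 1 ∧ (z = 1 ∨ z.re ≤ 1 / 2) := by
  by_cases hz : z = 0
  · simp [BSet, hz]
  · have h1 : 1 / z = 1 ↔ z = 1 := by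
      rw [one_div, inv_eq_one]
    simp only [BSet, Set.mem_ofPred_eq, one_le_norm_iff hz, norm_le_norm_sub_one_iff, h1]
    tauto

theorem one_mem_BSet : (1 : ℂ) ∈ BSet := by simp [BSet]

theorem dual_mem_BSet {z : ℂ} (hz : z ∈ BSet) (h1 : z ≠ 1) : z / (z - 1) ∈ BSet := by
  obtain ⟨⟨hn, h0⟩, h⟩ := hz
  have h2 : z - 1 ≠ 0 := sub_ne_zero.2 h1
  have h' : ‖z‖ ≤ ‖z - 1‖ := by
    rcases h with h | h
    · rw [one_div, inv_eq_one] at h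
      exact absurd h h1
    · exact (one_le_norm_iff h0).1 h
  refine ⟨⟨?_, div_ne_zero h0 h2⟩, Or.inr ?_⟩
  · rw [norm_div]
    exact div_le_one_of_le₀ h' (norm_nonneg _)
  · rw [one_le_norm_iff (div_ne_zero h0 h2)]
    have h3 : z / (z - 1) - 1 = 1 / (z - 1) := by field_simp; ring
    rw [h3, norm_div, norm_div, norm_one]
    gcongr

/-- The letters `x` and `e_z`, `z ∈ 𝔹`. -/
inductive Letter : Type
  | x : Letter
  | e (z : BSet) : Letter

/-- The non-commutative polynomial algebra `ℚ⟨x, e_z (z ∈ 𝔹)⟩`. -/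
abbrev Alg : Type := FreeAlgebra ℚ Letter

/-- The generator `x`. -/
def gx : Alg := FreeAlgebra.ι ℚ Letter.x

/-- The generator `e_z`. -/
def ge (z : BSet) : Alg := FreeAlgebra.ι ℚ (Letter.e z)

/-- The element `1` of `𝔹`. -/
def oneB : BSet := ⟨1, one_mem_BSet⟩

/-- The element `z / (z - 1)` of `𝔹`, for `z ∈ 𝔹`, `z ≠ 1`. -/
def dualB (z : BSet) (h : z ≠ oneB) : BSet :=
  ⟨(z : ℂ) / ((z : ℂ) - 1), dual_mem_BSet z.2 fun h1 => h (Subtype.ext h1)⟩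

theorem dualB_ne (z : BSet) (h : z ≠ oneB) : dualB z h ≠ oneB := by
  intro h1
  have h2 : (z : ℂ) / ((z : ℂ) - 1) = 1 := congrArg Subtype.val h1
  have h3 : (z : ℂ) - 1 ≠ 0 := sub_ne_zero.2 fun h4 => h (Subtype.ext h4)
  rw [div_eq_one_iff_eq h3] at h2
  exact one_ne_zero (α := ℂ) (by linear_combination h2)

theorem dualB_dualB (z : BSet) (h : z ≠ oneB) : dualB (dualB z h) (dualB_ne z h) = z := by
  apply Subtype.ext
  have h3 : (z : ℂ) - 1 ≠ 0 := sub_ne_zero.2 fun h4 => h (Subtype.ext h4)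
  change (z : ℂ) / ((z : ℂ) - 1) / ((z : ℂ) / ((z : ℂ) - 1) - 1) = z
  have h4 : (z : ℂ) / ((z : ℂ) - 1) - 1 = 1 / ((z : ℂ) - 1) := by field_simp; ring
  rw [h4]
  field_simp

/-- The subspace `𝒜⁰` of `𝒜`: the sum of `ℚ`, of the `ℚ e_z` (`Re z ≠ 1/2`, `|z| ≠ 1`), of the
`e_z 𝒜 x` (`Re z ≠ 1/2`) and of the `e_z 𝒜 e_{z'}` (`Re z ≠ 1/2`, `|z'| ≠ 1`). -/
def A0 : Submodule ℚ Alg :=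
  Submodule.span ℚ {1}
    ⊔ Submodule.span ℚ {w | ∃ z : BSet, (z : ℂ).re ≠ 1 / 2 ∧ ‖(z : ℂ)‖ ≠ 1 ∧ w = ge z}
    ⊔ Submodule.span ℚ {w | ∃ (z : BSet) (a : Alg), (z : ℂ).re ≠ 1 / 2 ∧ w = ge z * a * gx}
    ⊔ Submodule.span ℚ {w | ∃ (z z' : BSet) (a : Alg),
        (z : ℂ).re ≠ 1 / 2 ∧ ‖(z' : ℂ)‖ ≠ 1 ∧ w = ge z * a * ge z'}

/-- `𝒜⁰⟦t⟧` inside `𝒜⟦t⟧`: the power series with all coefficients in `𝒜⁰`. -/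
def A0t : Submodule ℚ Alg⟦X⟧ where
  carrier := {f | ∀ n, PowerSeries.coeff n f ∈ A0}
  zero_mem' n := by simp
  add_mem' hf hg n := by simpa using A0.add_mem (hf n) (hg n)
  smul_mem' c f hf n := by
    change c • PowerSeries.coeff n f ∈ A0
    exact A0.smul_mem c (hf n)

/-! ### The evaluation map -/

/-- The word `e_{z_1} x^{k_1 - 1} ⋯ e_{z_r} x^{k_r - 1}` associated with `(z, k)`, given as the
list of the pairs `(z_i, k_i)`. -/
def word : List (BSet × ℕ+) → List Letter
  | [] => []
  | p :: s => Letter.e p.1 :: (List.replicate ((p.2 : ℕ) - 1) Letter.x ++ word s)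

/-- The number of initial letters `x` of a word, and the list `(z, k)` with which the rest of the
word is associated. -/
def scan : List Letter → ℕ × List (BSet × ℕ+)
  | [] => (0, [])
  | Letter.x :: w => ((scan w).1 + 1, (scan w).2)
  | Letter.e z :: w => (0, (z, (scan w).1.succPNat) :: (scan w).2)

theorem scan_replicate (n : ℕ) (w : List Letter) :
    scan (List.replicate n Letter.x ++ w) = ((scan w).1 + n, (scan w).2) := by
  induction n with
  | zero => simp
  | succ n ih => simp [List.replicate_succ, scan, ih, add_assoc]

theorem scan_word (s : List (BSet × ℕ+)) : scan (word s) = (0, s) := by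
  induction s with
  | nil => rfl
  | cons p s ih =>
    obtain ⟨z, k⟩ := p
    simp only [word, scan, scan_replicate, ih, Prod.mk.injEq, List.cons.injEq, and_true, true_and]
    apply PNat.eq
    simp only [Nat.succPNat_coe, zero_add]
    have := k.pos
    omega

/-- The entries `k_i` of the pair `(z, k)`. -/
def idx (s : List (BSet × ℕ+)) (i : Fin s.length) : ℕ+ := (s.get i).2

/-- The entries `z_i` of the pair `(z, k)`. -/
def arg (s : List (BSet × ℕ+)) (i : Fin s.length) : ℂ := ((s.get i).1 : ℂ)

/-- The element of `𝒜` given by a word, that is, the product of its letters. -/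
def ofWord (w : List Letter) : Alg := (w.map (FreeAlgebra.ι ℚ)).prod

/-- The linear map `L : 𝒜⁰ → ℂ` that sends a word associated with `(z, k)` to `Li_k(z)`. -/
def L0 : A0 →ₗ[ℚ] ℂ :=
  ((FreeAlgebra.basisFreeMonoid ℚ Letter).constr ℚ fun w : FreeMonoid Letter =>
    shuffleLi (idx (scan w.toList).2) (arg (scan w.toList).2)).domRestrict A0

theorem basisFreeMonoid_apply (w : List Letter) :
    FreeAlgebra.basisFreeMonoid ℚ Letter (FreeMonoid.ofList w) = ofWord w := by
  simp only [FreeAlgebra.basisFreeMonoid, Module.Basis.map_apply, Finsupp.coe_basisSingleOne]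
  change FreeAlgebra.equivMonoidAlgebraFreeMonoid.symm (MonoidAlgebra.single _ 1) = _
  change (MonoidAlgebra.lift ℚ (FreeAlgebra ℚ Letter) (FreeMonoid Letter)
    (FreeMonoid.lift (FreeAlgebra.ι ℚ))) (MonoidAlgebra.single (FreeMonoid.ofList w) 1) = _
  rw [MonoidAlgebra.lift_single, one_smul, FreeMonoid.lift_apply]
  rfl

/-- The defining property of `L` on the words of `𝒜⁰`. -/
theorem L0_word (s : List (BSet × ℕ+)) (h : ofWord (word s) ∈ A0) :
    L0 ⟨ofWord (word s), h⟩ = shuffleLi (idx s) (arg s) := by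
  simp only [L0, LinearMap.domRestrict_apply]
  rw [← basisFreeMonoid_apply, Module.Basis.constr_basis]
  rw [FreeMonoid.toList_ofList, scan_word]

/-- The linear map `L : 𝒜⁰⟦t⟧ → ℂ⟦t⟧`, `∑ w_i t^i ↦ ∑ L(w_i) t^i`. -/
def L : A0t →ₗ[ℚ] ℂ⟦X⟧ where
  toFun f := PowerSeries.mk fun n => L0 ⟨PowerSeries.coeff n f.1, f.2 n⟩
  map_add' f g := by
    ext n
    rw [map_add, PowerSeries.coeff_mk, PowerSeries.coeff_mk, PowerSeries.coeff_mk,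
      ← LinearMap.map_add]
    congr 1
  map_smul' c f := by
    ext n
    have h : ∀ g : ℂ⟦X⟧, PowerSeries.coeff n (c • g) = c • PowerSeries.coeff n g := fun g => rfl
    rw [RingHom.id_apply, h, PowerSeries.coeff_mk, PowerSeries.coeff_mk, ← LinearMap.map_smul]
    congr 1

/-! ### Extending maps `𝒜 → 𝒜⟦t⟧` to `𝒜⟦t⟧ → 𝒜⟦t⟧` with `t ↦ t` -/

section Extend

open PowerSeries Finset

/-- The extension `∑ w_i t^i ↦ ∑ φ(w_i) t^i` of a linear map `φ : 𝒜 → 𝒜⟦t⟧` to `𝒜⟦t⟧`. -/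
def extend (φ : Alg →ₗ[ℚ] Alg⟦X⟧) : Alg⟦X⟧ →ₗ[ℚ] Alg⟦X⟧ where
  toFun f := PowerSeries.mk fun n =>
    ∑ p ∈ antidiagonal n, coeff p.2 (φ (coeff p.1 f))
  map_add' f g := by
    ext n
    simp [sum_add_distrib]
  map_smul' c f := by
    ext n
    have h : ∀ (m : ℕ) (g : Alg⟦X⟧), coeff m (c • g) = c • coeff m g := fun m g => rfl
    rw [RingHom.id_apply, h, coeff_mk, coeff_mk, smul_sum]
    refine sum_congr rfl fun p _ => ?_
    rw [h, LinearMap.map_smul, h]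

theorem coeff_extend (φ : Alg →ₗ[ℚ] Alg⟦X⟧) (f : Alg⟦X⟧) (n : ℕ) :
    coeff n (extend φ f) = ∑ p ∈ antidiagonal n, coeff p.2 (φ (coeff p.1 f)) := by
  simp only [extend, LinearMap.coe_mk, AddHom.coe_mk, coeff_mk]

theorem extend_C (φ : Alg →ₗ[ℚ] Alg⟦X⟧) (a : Alg) : extend φ (C a) = φ a := by
  ext n
  rw [coeff_extend, sum_eq_single (0, n)]
  · simp
  · rintro ⟨i, j⟩ h hne
    rw [HasAntidiagonal.mem_antidiagonal] at h
    have : i ≠ 0 := by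
      rintro rfl
      simp_all
    simp [coeff_C, this]
  · simp

theorem extend_X (φ : Alg →ₗ[ℚ] Alg⟦X⟧) (h1 : φ 1 = 1) : extend φ X = X := by
  ext n
  rw [coeff_extend]
  have h : ∀ p ∈ antidiagonal n, coeff p.2 (φ (coeff p.1 (X : Alg⟦X⟧)))
      = if p = (1, 0) then 1 else 0 := by
    rintro ⟨i, j⟩ -
    by_cases hi : i = 1
    · subst hi
      simp [h1, coeff_one]
    · simp [coeff_X, hi]
  rw [sum_congr rfl h, sum_ite_eq']
  simp only [HasAntidiagonal.mem_antidiagonal, coeff_X, add_zero, eq_comm]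

theorem extend_mul (φ : Alg →ₗ[ℚ] Alg⟦X⟧) (h : ∀ a b, φ (a * b) = φ a * φ b) (f g : Alg⟦X⟧) :
    extend φ (f * g) = extend φ f * extend φ g := by
  ext n
  simp only [coeff_extend, coeff_mul, map_sum, h, sum_mul_sum]
  simp only [← sum_product', sum_sigma']
  refine sum_nbij' (fun p => ⟨(p.2.1.1 + p.2.2.1, p.2.1.2 + p.2.2.2),
      ((p.2.1.1, p.2.2.1), (p.2.1.2, p.2.2.2))⟩)
    (fun p => ⟨(p.2.1.1 + p.2.2.1, p.2.1.2 + p.2.2.2),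
      ((p.2.1.1, p.2.2.1), (p.2.1.2, p.2.2.2))⟩) ?_ ?_ ?_ ?_ ?_
  all_goals
    rintro ⟨⟨i, j⟩, ⟨⟨a, b⟩, ⟨c, d⟩⟩⟩ hp
    simp only [mem_sigma, mem_product, HasAntidiagonal.mem_antidiagonal] at hp
    obtain ⟨rfl, rfl, rfl⟩ := hp
  · simp only [mem_sigma, mem_product, HasAntidiagonal.mem_antidiagonal, and_true]
    ring
  · simp only [mem_sigma, mem_product, HasAntidiagonal.mem_antidiagonal, and_true]
    ring
  · rfl
  · rfl
  · rfl

theorem extend_mul_anti (φ : Alg →ₗ[ℚ] Alg⟦X⟧) (h : ∀ a b, φ (a * b) = φ b * φ a)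
    (f g : Alg⟦X⟧) : extend φ (f * g) = extend φ g * extend φ f := by
  ext n
  simp only [coeff_extend, coeff_mul, map_sum, h, sum_mul_sum]
  simp only [← sum_product', sum_sigma']
  refine sum_nbij' (fun p => ⟨(p.2.1.2 + p.2.2.1, p.2.1.1 + p.2.2.2),
      ((p.2.1.2, p.2.2.1), (p.2.1.1, p.2.2.2))⟩)
    (fun p => ⟨(p.2.1.1 + p.2.2.1, p.2.1.2 + p.2.2.2),
      ((p.2.2.1, p.2.1.1), (p.2.1.2, p.2.2.2))⟩) ?_ ?_ ?_ ?_ ?_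
  all_goals
    rintro ⟨⟨i, j⟩, ⟨⟨a, b⟩, ⟨c, d⟩⟩⟩ hp
    simp only [mem_sigma, mem_product, HasAntidiagonal.mem_antidiagonal] at hp
    obtain ⟨rfl, rfl, rfl⟩ := hp
  · simp only [mem_sigma, mem_product, HasAntidiagonal.mem_antidiagonal, and_true]
    ring
  · simp only [mem_sigma, mem_product, HasAntidiagonal.mem_antidiagonal]
    exact ⟨by ring, add_comm _ _, trivial⟩
  · simp [add_comm]
  · simp
  · rfl

theorem extend_extend (φ ψ : Alg →ₗ[ℚ] Alg⟦X⟧) (f : Alg⟦X⟧) :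
    extend φ (extend ψ f) = extend (extend φ ∘ₗ ψ) f := by
  ext n
  simp only [coeff_extend, LinearMap.comp_apply, map_sum]
  simp only [sum_sigma']
  refine sum_nbij' (fun p => ⟨(p.2.1, p.2.2 + p.1.2), (p.2.2, p.1.2)⟩)
    (fun p => ⟨(p.1.1 + p.2.1, p.2.2), (p.1.1, p.2.1)⟩) ?_ ?_ ?_ ?_ ?_
  all_goals
    rintro ⟨⟨i, j⟩, ⟨a, b⟩⟩ hp
    simp only [mem_sigma, HasAntidiagonal.mem_antidiagonal] at hp
    obtain ⟨rfl, rfl⟩ := hp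
  · simp only [mem_sigma, HasAntidiagonal.mem_antidiagonal, and_true]
    ring
  · simp only [mem_sigma, HasAntidiagonal.mem_antidiagonal, and_true]
    ring
  · rfl
  · rfl
  · rfl

theorem extend_id (φ : Alg →ₗ[ℚ] Alg⟦X⟧) (h : ∀ a, φ a = C a) (f : Alg⟦X⟧) :
    extend φ f = f := by
  ext n
  rw [coeff_extend, sum_eq_single (n, 0)]
  · simp [h]
  · rintro ⟨i, j⟩ hp hne
    rw [HasAntidiagonal.mem_antidiagonal] at hp
    have : j ≠ 0 := by
      rintro rfl
      simp_all
    simp [h, coeff_C, this]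
  · simp

/-- The inverse `(1 - a t)⁻¹ = ∑ a^n t^n` in `𝒜⟦t⟧`. -/
def geom (a : Alg) : Alg⟦X⟧ := PowerSeries.mk fun n => a ^ n

theorem geom_mul (a : Alg) : geom a * (1 - C a * X) = 1 := by
  ext n
  rw [mul_sub, mul_one, ← mul_assoc, map_sub]
  cases n with
  | zero => simp [geom]
  | succ n => rw [coeff_succ_mul_X, coeff_mul_C]; simp [geom, pow_succ, coeff_one]

theorem mul_geom (a : Alg) : (1 - C a * X) * geom a = 1 := by
  ext n
  rw [sub_mul, one_mul, mul_assoc, X_mul, ← mul_assoc, map_sub]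
  cases n with
  | zero => simp [geom]
  | succ n => rw [coeff_succ_mul_X, coeff_C_mul]; simp [geom, pow_succ', coeff_one]

end Extend

/-! ### The automorphism `σ` -/

section Sigma

open PowerSeries

/-- `σ` on the generators: `x ↦ x`, `e_z ↦ e_z (1 - x t)⁻¹`. -/
def sigmaGen : Letter → Alg⟦X⟧
  | Letter.x => C gx
  | Letter.e z => C (ge z) * geom gx

/-- The inverse of `σ` on the generators: `x ↦ x`, `e_z ↦ e_z (1 - x t)`. -/
def sigmaInvGen : Letter → Alg⟦X⟧
  | Letter.x => C gx
  | Letter.e z => C (ge z) * (1 - C gx * X)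

/-- The ring endomorphism of `𝒜⟦t⟧` with `t ↦ t` and with given images of the generators. -/
def extHom (s : Letter → Alg⟦X⟧) : Alg⟦X⟧ →ₐ[ℚ] Alg⟦X⟧ :=
  AlgHom.ofLinearMap (extend (FreeAlgebra.lift ℚ s).toLinearMap)
    (by rw [← (C (R := Alg)).map_one, extend_C]; simp)
    (extend_mul _ (by simp))

theorem extHom_C (s : Letter → Alg⟦X⟧) (a : Alg) : extHom s (C a) = FreeAlgebra.lift ℚ s a :=
  extend_C _ a

theorem extHom_gen (s : Letter → Alg⟦X⟧) (u : Letter) :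
    extHom s (C (FreeAlgebra.ι ℚ u)) = s u := by
  rw [extHom_C, FreeAlgebra.lift_ι_apply]

theorem extHom_X (s : Letter → Alg⟦X⟧) : extHom s X = X :=
  extend_X _ (by simp)

/-- `C : 𝒜 → 𝒜⟦t⟧` as a morphism of algebras. -/
def CHom : Alg →ₐ[ℚ] Alg⟦X⟧ := { (C : Alg →+* Alg⟦X⟧) with
  commutes' := fun r => by
    ext n
    rw [PowerSeries.algebraMap_apply]
    rfl }

theorem extHom_comp (s s' : Letter → Alg⟦X⟧)
    (h : ∀ u, extHom s (s' u) = C (FreeAlgebra.ι ℚ u)) (f : Alg⟦X⟧) :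
    extHom s (extHom s' f) = f := by
  have h1 : (extHom s).comp (FreeAlgebra.lift ℚ s') = CHom := by
    apply FreeAlgebra.hom_ext
    funext u
    simp only [Function.comp_apply, AlgHom.comp_apply, FreeAlgebra.lift_ι_apply, h]
    rfl
  refine (extend_extend _ _ f).trans (extend_id _ (fun a => ?_) f)
  exact DFunLike.congr_fun h1 a

/-- The automorphism `σ` of `𝒜⟦t⟧` with `x ↦ x`, `e_z ↦ e_z (1 - x t)⁻¹` and `t ↦ t`. -/
def sigma : Alg⟦X⟧ ≃ₐ[ℚ] Alg⟦X⟧ :=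
  AlgEquiv.ofAlgHom (extHom sigmaGen) (extHom sigmaInvGen)
    (AlgHom.ext fun f => extHom_comp _ _ (by
      rintro (_ | z)
      · exact extHom_gen _ Letter.x
      · have hx : extHom sigmaGen (C gx) = C gx := extHom_gen _ Letter.x
        have he : extHom sigmaGen (C (ge z)) = C (ge z) * geom gx := extHom_gen _ (Letter.e z)
        change extHom sigmaGen (C (ge z) * (1 - C gx * X)) = C (ge z)
        rw [map_mul, map_sub, map_one, map_mul, hx, he, extHom_X, mul_assoc, geom_mul, mul_one]) f)
    (AlgHom.ext fun f => extHom_comp _ _ (by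
      rintro (_ | z)
      · exact extHom_gen _ Letter.x
      · have hx : extHom sigmaInvGen (C gx) = C gx := extHom_gen _ Letter.x
        have he : extHom sigmaInvGen (C (ge z)) = C (ge z) * (1 - C gx * X) :=
          extHom_gen _ (Letter.e z)
        have hg := congrArg (extHom sigmaInvGen) (mul_geom gx)
        rw [map_mul, map_sub, map_one, map_mul, hx, extHom_X] at hg
        change extHom sigmaInvGen (C (ge z) * geom gx) = C (ge z)
        rw [map_mul, he, mul_assoc, hg, mul_one]) f)

theorem sigma_x : sigma (C gx) = C gx := extHom_gen _ Letter.x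

theorem sigma_e (z : BSet) : sigma (C (ge z)) = C (ge z) * geom gx := extHom_gen _ (Letter.e z)

theorem sigma_t : sigma X = X := extHom_X _

end Sigma

/-! ### The anti-automorphism `τ` -/

section Tau

open PowerSeries MulOpposite

open scoped Classical in
/-- `τ` on the generators: `x ↦ e_1`, `e_1 ↦ x`, and
`e_z ↦ -e_{z'} (1 - e_{z'} t)⁻¹` with `z' = z / (z - 1)` for `z ≠ 1`. -/
def tauGen : Letter → Alg⟦X⟧
  | Letter.x => C (ge oneB)
  | Letter.e z => if h : z = oneB then C gx else -(C (ge (dualB z h)) * geom (ge (dualB z h)))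

/-- The anti-multiplicative map `𝒜 → 𝒜⟦t⟧` with the images `tauGen` of the generators. -/
def tauLin : Alg →ₗ[ℚ] Alg⟦X⟧ :=
  (opLinearEquiv ℚ (M := Alg⟦X⟧)).symm.toLinearMap ∘ₗ
    (FreeAlgebra.lift ℚ fun u => op (tauGen u)).toLinearMap

theorem tauLin_mul (a b : Alg) : tauLin (a * b) = tauLin b * tauLin a := by
  simp [tauLin]

theorem tauLin_one : tauLin 1 = 1 := by
  simp [tauLin]

theorem tauLin_gen (u : Letter) : tauLin (FreeAlgebra.ι ℚ u) = tauGen u := by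
  simp [tauLin]

/-- `τ` as a map `𝒜⟦t⟧ → 𝒜⟦t⟧`. -/
def tauMap : Alg⟦X⟧ →ₗ[ℚ] Alg⟦X⟧ := extend tauLin

theorem tauMap_mul (f g : Alg⟦X⟧) : tauMap (f * g) = tauMap g * tauMap f :=
  extend_mul_anti _ tauLin_mul f g

theorem tauMap_one : tauMap 1 = 1 := by
  rw [← (C (R := Alg)).map_one, tauMap, extend_C, tauLin_one]
  simp

theorem tauMap_X : tauMap X = X := extend_X _ tauLin_one

theorem tauMap_gen (u : Letter) : tauMap (C (FreeAlgebra.ι ℚ u)) = tauGen u := by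
  rw [tauMap, extend_C, tauLin_gen]

theorem tauMap_tauGen (u : Letter) : tauMap (tauGen u) = C (FreeAlgebra.ι ℚ u) := by
  obtain _ | z := u
  · refine (tauMap_gen (Letter.e oneB)).trans ?_
    simp only [tauGen, dite_true]
    rfl
  · by_cases h : z = oneB
    · subst h
      simp only [tauGen, dite_true]
      exact tauMap_gen Letter.x
    · simp only [tauGen, h, dite_false, map_neg]
      have he : tauMap (C (ge (dualB z h))) = -(C (ge z) * geom (ge z)) := by
        refine (tauMap_gen (Letter.e (dualB z h))).trans ?_
        simp only [tauGen, dualB_ne z h, dite_false, dualB_dualB]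
      have hg := congrArg tauMap (geom_mul (ge (dualB z h)))
      rw [tauMap_mul, map_sub, tauMap_one, tauMap_mul, he, tauMap_X] at hg
      have h1 := mul_geom (ge z)
      have h2 := geom_mul (ge z)
      set G := geom (ge z) with hG
      have h3 : 1 - X * -(C (ge z) * G) = G := by
        rw [mul_neg, sub_neg_eq_add, ← mul_assoc, X_mul]
        calc 1 + C (ge z) * X * G = 1 + (G - (1 - C (ge z) * X) * G) := by noncomm_ring
          _ = G := by rw [h1]; noncomm_ring
      rw [h3] at hg
      have h4 : tauMap (geom (ge (dualB z h))) = 1 - C (ge z) * X := by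
        calc tauMap (geom (ge (dualB z h)))
            = (1 - C (ge z) * X) * G * tauMap (geom (ge (dualB z h))) := by rw [h1, one_mul]
          _ = 1 - C (ge z) * X := by rw [mul_assoc, hg, mul_one]
      have h5 : (1 - C (ge z) * X) * C (ge z) = C (ge z) * (1 - C (ge z) * X) := by
        rw [sub_mul, mul_sub, one_mul, mul_one, mul_assoc, X_mul]
      rw [tauMap_mul, he, h4, mul_neg, neg_neg, ← mul_assoc, h5, mul_assoc, h1, mul_one]
      rfl

theorem tauMap_tauMap (f : Alg⟦X⟧) : tauMap (tauMap f) = f := by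
  let T : Alg →ₐ[ℚ] Alg⟦X⟧ := AlgHom.ofLinearMap (tauMap ∘ₗ tauLin)
    (by rw [LinearMap.comp_apply, tauLin_one, tauMap_one])
    (fun a b => by simp only [LinearMap.comp_apply, tauLin_mul, tauMap_mul])
  have h1 : T = CHom := by
    apply FreeAlgebra.hom_ext
    funext u
    change tauMap (tauLin (FreeAlgebra.ι ℚ u)) = C (FreeAlgebra.ι ℚ u)
    rw [tauLin_gen, tauMap_tauGen]
  refine (extend_extend _ _ f).trans (extend_id _ (fun a => ?_) f)
  exact DFunLike.congr_fun h1 a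

/-- The anti-automorphism `τ` of `𝒜⟦t⟧` with `x ↦ e_1`, `e_1 ↦ x`,
`e_z ↦ -e_{z/(z-1)} (1 - e_{z/(z-1)} t)⁻¹` for `z ≠ 1`, and `t ↦ t`; as an isomorphism onto the
opposite algebra. -/
def tau : Alg⟦X⟧ ≃ₐ[ℚ] (Alg⟦X⟧)ᵐᵒᵖ :=
  AlgEquiv.ofLinearEquiv
    ((LinearEquiv.ofInvolutive tauMap tauMap_tauMap).trans (opLinearEquiv ℚ))
    (congrArg op tauMap_one) (fun f g => congrArg op (tauMap_mul f g))

theorem tau_x : unop (tau (C gx)) = C (ge oneB) := tauMap_gen Letter.x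

theorem tau_e_one : unop (tau (C (ge oneB))) = C gx :=
  (tauMap_gen (Letter.e oneB)).trans (by simp only [tauGen, dite_true])

theorem tau_e (z : BSet) (h : z ≠ oneB) :
    unop (tau (C (ge z))) = -(C (ge (dualB z h)) * geom (ge (dualB z h))) :=
  (tauMap_gen (Letter.e z)).trans (by simp only [tauGen, h, dite_false])

theorem tau_t : unop (tau X) = X := tauMap_X

end Tau

end

end HoffmanMPL

/-! The proof is by connected sums. Words act as triangular kernels on ℕ: `x` is the diagonal kernel
1/a, and e_z is z^(a-m)/a for m < a, so row 0 of the kernel of a word of 𝒜⁰ sums to its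
polylogarithm (`hasSum_rho_LFull`). Under σ the factor 1/a of e_z becomes 1/(a - t). Put C(m, n) =
∏_{j≤m}(j - t) ∏_{j≤n}(j - t) / ∏_{j≤m+n}(j - t). If K and K' are the kernels of σ(l) and σ(τ(l))
for a letter l, then Σ_a K(m, a) C(a, n) = Σ_b K'(n, b) C(m, b), under boundary conditions at m = 0
and n = 0 (`transports_kerS_kerST`). For a word uv, pair row 0 of σ(u) with row 0 of σ(τ(v)) through
C. As τ reverses products, the relation moves the last letter of u to the front of v without
changing the sum (`connSum_transport`). Since C(m, 0) = 1, the two extreme cuts give the two sides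
of the theorem (`tsum_rowS_eq_tsum_rowST`).

Up to a common factor, both sides of the transport relation are generating series of beta values,
formally ∫ s^(m-t) (1-s)^n ds over [0, 1]. With w = z/(z - 1) the relation is w/(1 - w(1-s)) = -z/(1
- zs) under the integral. The proof needs only Pascal's rule for beta values and a limit
(`hasSum_betX_right`).

For convergence, seminorms on ℂ⟦t⟧ that give t the weight 1/4 reduce every estimate to the real
value t = 1/4. The sequence `phi`, of order n^(-1/4), is reproduced by the kernels (`row_mul_le`),
phi n / n is summable, and C(m, n) is at most 8/(mn) for m, n ≥ 1. At m = 0 or n = 0 the connector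
gives no decay; there the conditions on the first and last letters of words of 𝒜⁰ take over. -/

namespace HoffmanMPL

open Finset Filter Topology

open scoped PowerSeries.WithPiTopology

/-! ### The connector and Pascal's rule -/

section Connector

variable {S : Type*} [CommRing S]

/-- The product `∏_{j=1}^n (j - t)`. -/
def fac (t : S) (n : ℕ) : S := ∏ j ∈ range n, (((j + 1 : ℕ) : S) - t)

/-- The product `∏_{j=1}^n r_j`. -/
def rfac (r : ℕ → S) (n : ℕ) : S := ∏ j ∈ range n, r (j + 1)

/-- The connector `∏_{j ≤ m} (j - t) ∏_{j ≤ n} (j - t) ∏_{j ≤ m + n} r_j`. -/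
def conn (t : S) (r : ℕ → S) (m n : ℕ) : S := fac t m * fac t n * rfac r (m + n)

/-- The element `n! ∏_{j ≤ m} (j - t) ∏_{j ≤ m + n + 1} r_j`, a beta value when `r_j = 1 / (j - t)`. -/
def bet (t : S) (r : ℕ → S) (m n : ℕ) : S :=
  (n.factorial : S) * fac t m * rfac r (m + n + 1)

theorem fac_succ (t : S) (n : ℕ) : fac t (n + 1) = fac t n * (((n + 1 : ℕ) : S) - t) :=
  prod_range_succ _ _

theorem rfac_succ (r : ℕ → S) (n : ℕ) : rfac r (n + 1) = rfac r n * r (n + 1) :=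
  prod_range_succ _ _

@[simp] theorem fac_zero (t : S) : fac t 0 = 1 := rfl

@[simp] theorem rfac_zero (r : ℕ → S) : rfac r 0 = 1 := rfl

theorem conn_comm (t : S) (r : ℕ → S) (m n : ℕ) : conn t r m n = conn t r n m := by
  rw [conn, conn, add_comm m n]; ring

variable {t : S} {r : ℕ → S}

theorem fac_mul_rfac (h : ∀ n : ℕ, (((n + 1 : ℕ) : S) - t) * r (n + 1) = 1) (n : ℕ) :
    fac t n * rfac r n = 1 := by
  induction n with
  | zero => simp
  | succ n ih =>
    rw [fac_succ, rfac_succ]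
    linear_combination ih + fac t n * rfac r n * h n

theorem conn_zero_right (h : ∀ n : ℕ, (((n + 1 : ℕ) : S) - t) * r (n + 1) = 1) (m : ℕ) :
    conn t r m 0 = 1 := by
  simpa [conn] using fac_mul_rfac h m

theorem conn_succ_left (m n : ℕ) :
    conn t r (m + 1) n = conn t r m n * ((((m + 1 : ℕ) : S) - t) * r (m + n + 1)) := by
  rw [conn, conn, fac_succ, show m + 1 + n = m + n + 1 by ring, rfac_succ]
  ring

/-- For r_j = 1/(j - t) this is s + (1 - s) = 1 under the beta integral. -/
theorem bet_pascal (h : ∀ n : ℕ, (((n + 1 : ℕ) : S) - t) * r (n + 1) = 1) (m n : ℕ) :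
    bet t r m n = bet t r (m + 1) n + bet t r m (n + 1) := by
  rw [bet, bet, bet, fac_succ, show m + 1 + n + 1 = m + n + 1 + 1 by ring,
    show m + (n + 1) + 1 = m + n + 1 + 1 by ring, rfac_succ r (m + n + 1), Nat.factorial_succ]
  have := h (m + n + 1)
  push_cast at this ⊢
  linear_combination -((n.factorial : S) * fac t m * rfac r (m + n + 1)) * this

theorem bet_zero_right (h : ∀ n : ℕ, (((n + 1 : ℕ) : S) - t) * r (n + 1) = 1) (m : ℕ) :
    bet t r m 0 = r (m + 1) := by
  rw [bet, add_zero, rfac_succ]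
  have := fac_mul_rfac h m
  simp only [Nat.factorial_zero, Nat.cast_one]
  linear_combination r (m + 1) * this

theorem bet_zero_left_succ (n : ℕ) :
    bet t r 0 (n + 1) = bet t r 0 n * (((n + 1 : ℕ) : S) * r (n + 2)) := by
  rw [bet, bet, show 0 + (n + 1) + 1 = n + 1 + 1 by ring, rfac_succ, Nat.factorial_succ,
    show 0 + n + 1 = n + 1 by ring]
  push_cast
  ring

/-- The factor r_{a+1} of a kernel entry turns the connector into a beta value; what remains depends
only on n, so it leaves the sum over a. Factorials stay on the left because `S` need not allow
division. -/
theorem mul_conn_eq_bet (h : ∀ n : ℕ, (((n + 1 : ℕ) : S) - t) * r (n + 1) = 1) (a n : ℕ) :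
    (n.factorial : S) * (r (a + 1) * conn t r (a + 1) n) = fac t n * bet t r a n := by
  rw [conn, bet, fac_succ, show a + 1 + n = a + n + 1 by ring]
  linear_combination (n.factorial : S) * fac t a * fac t n * rfac r (a + n + 1) * h a

theorem conn_eq_bet (m n : ℕ) :
    (n.factorial : S) * conn t r m (n + 1) = fac t (n + 1) * bet t r m n := by
  rw [conn, bet, show m + (n + 1) = m + n + 1 by ring]
  ring

end Connector

/-! ### Truncated weighted norms of power series -/

/-- The seminorm `∑_{j ≤ J} |c_j| 4^{-j}` of `∑ c_j t^j`. -/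
noncomputable def nrm (J : ℕ) (f : ℂ⟦X⟧) : ℝ :=
  ∑ j ∈ range (J + 1), ‖PowerSeries.coeff j f‖ * (1 / 4) ^ j

theorem nrm_nonneg (J : ℕ) (f : ℂ⟦X⟧) : 0 ≤ nrm J f := by
  unfold nrm; positivity

@[simp] theorem nrm_zero (J : ℕ) : nrm J 0 = 0 := by simp [nrm]

@[simp] theorem nrm_neg (J : ℕ) (f : ℂ⟦X⟧) : nrm J (-f) = nrm J f := by simp [nrm]

theorem nrm_add_le (J : ℕ) (f g : ℂ⟦X⟧) : nrm J (f + g) ≤ nrm J f + nrm J g := by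
  rw [nrm, nrm, nrm, ← sum_add_distrib]
  refine sum_le_sum fun j _ => ?_
  rw [← add_mul, map_add]
  gcongr
  exact norm_add_le _ _

theorem nrm_sum_le {ι : Type*} (J : ℕ) (s : Finset ι) (f : ι → ℂ⟦X⟧) :
    nrm J (∑ i ∈ s, f i) ≤ ∑ i ∈ s, nrm J (f i) :=
  Finset.le_sum_of_subadditive (nrm J) (nrm_zero J).le (nrm_add_le J) s f

/-- Truncation does no harm: the pairs of degrees with sum at most J lie in the square of pairs at
most J, and all terms are nonnegative. -/
theorem nrm_mul_le (J : ℕ) (f g : ℂ⟦X⟧) : nrm J (f * g) ≤ nrm J f * nrm J g := by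
  have h1 : nrm J (f * g) ≤ ∑ j ∈ range (J + 1), ∑ p ∈ antidiagonal j,
      (‖PowerSeries.coeff p.1 f‖ * (1 / 4) ^ p.1) * (‖PowerSeries.coeff p.2 g‖ * (1 / 4) ^ p.2) := by
    refine sum_le_sum fun j _ => ?_
    rw [PowerSeries.coeff_mul]
    calc _ ≤ (∑ p ∈ antidiagonal j, ‖PowerSeries.coeff p.1 f * PowerSeries.coeff p.2 g‖)
          * (1 / 4 : ℝ) ^ j := by gcongr; exact norm_sum_le _ _
      _ = _ := by
        rw [sum_mul]
        refine sum_congr rfl fun p hp => ?_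
        rw [← HasAntidiagonal.mem_antidiagonal.1 hp, norm_mul, pow_add]
        ring
  refine h1.trans ?_
  rw [nrm, nrm, sum_mul_sum, ← sum_product', sum_sigma']
  have hinj : Set.InjOn (fun x : (_ : ℕ) × ℕ × ℕ => x.2)
      ((range (J + 1)).sigma fun j => antidiagonal j : Finset ((_ : ℕ) × ℕ × ℕ)) := by
    rintro ⟨i, p⟩ hp ⟨j, q⟩ hq rfl
    have hp := HasAntidiagonal.mem_antidiagonal.1 (mem_sigma.1 hp).2
    have hq := HasAntidiagonal.mem_antidiagonal.1 (mem_sigma.1 hq).2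
    exact Sigma.ext (hp.symm.trans hq) HEq.rfl
  rw [← sum_image (f := fun p : ℕ × ℕ => (‖PowerSeries.coeff p.1 f‖ * (1 / 4) ^ p.1) *
    (‖PowerSeries.coeff p.2 g‖ * (1 / 4) ^ p.2)) hinj]
  refine sum_le_sum_of_subset_of_nonneg ?_ fun _ _ _ => by positivity
  rintro p hp
  obtain ⟨⟨i, q⟩, hq, rfl⟩ := mem_image.1 hp
  simp only [mem_sigma, mem_range, HasAntidiagonal.mem_antidiagonal, mem_product] at hq ⊢
  omega

theorem nrm_C (J : ℕ) (c : ℂ) : nrm J (PowerSeries.C c) = ‖c‖ := by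
  rw [nrm, sum_range_succ']
  simp [PowerSeries.coeff_C]

theorem nrm_natCast (J n : ℕ) : nrm J (n : ℂ⟦X⟧) = n := by
  have h : (n : ℂ⟦X⟧) = PowerSeries.C (n : ℂ) := by simp
  rw [h, nrm_C]; simp

theorem nrm_one (J : ℕ) : nrm J 1 = 1 := by
  simpa using nrm_natCast J 1

theorem nrm_X_le (J : ℕ) : nrm J (PowerSeries.X) ≤ 1 / 4 := by
  rw [nrm]
  simp only [PowerSeries.coeff_X, apply_ite norm, norm_one, norm_zero, ite_mul, one_mul, zero_mul,
    sum_ite_eq']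
  split_ifs <;> norm_num

theorem norm_coeff_le (j : ℕ) (f : ℂ⟦X⟧) : ‖PowerSeries.coeff j f‖ ≤ 4 ^ j * nrm j f := by
  have h : ‖PowerSeries.coeff j f‖ * (1 / 4) ^ j ≤ nrm j f :=
    single_le_sum (f := fun j => ‖PowerSeries.coeff j f‖ * (1 / 4 : ℝ) ^ j)
      (fun i _ => by positivity) (self_mem_range_succ j)
  calc ‖PowerSeries.coeff j f‖ = 4 ^ j * (‖PowerSeries.coeff j f‖ * (1 / 4) ^ j) := by
        rw [mul_left_comm, ← mul_pow]; norm_num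
    _ ≤ _ := by gcongr

theorem nrm_prod_le {ι : Type*} (J : ℕ) (s : Finset ι) (f : ι → ℂ⟦X⟧) (c : ι → ℝ)
    (h : ∀ i ∈ s, nrm J (f i) ≤ c i) : nrm J (∏ i ∈ s, f i) ≤ ∏ i ∈ s, c i := by
  classical
  induction s using Finset.induction_on with
  | empty => simp [nrm_one]
  | insert a s ha ih =>
    rw [prod_insert ha, prod_insert ha]
    refine (nrm_mul_le _ _ _).trans (mul_le_mul (h a (mem_insert_self _ _))
      (ih fun i hi => h i (mem_insert_of_mem hi)) (nrm_nonneg _ _)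
      ((nrm_nonneg _ _).trans (h a (mem_insert_self _ _))))

/-- The inverse `1 / (a - t) = ∑ t^j / a^{j+1}` of `a - t`. -/
noncomputable def recip (a : ℕ) : ℂ⟦X⟧ := PowerSeries.mk fun j => 1 / (a : ℂ) ^ (j + 1)

theorem sub_X_mul_recip (n : ℕ) :
    (((n + 1 : ℕ) : ℂ⟦X⟧) - PowerSeries.X) * recip (n + 1) = 1 := by
  ext j
  have h0 : ((n + 1 : ℕ) : ℂ) ≠ 0 := Nat.cast_ne_zero.2 n.succ_ne_zero
  have h : ((n + 1 : ℕ) : ℂ⟦X⟧) = PowerSeries.C ((n + 1 : ℕ) : ℂ) := by simp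
  rw [h, sub_mul, map_sub, PowerSeries.coeff_C_mul]
  cases j with
  | zero => simp [recip]; field_simp
  | succ j =>
    rw [mul_comm PowerSeries.X, PowerSeries.coeff_succ_mul_X]
    simp only [recip, PowerSeries.coeff_mk, PowerSeries.coeff_one, Nat.succ_ne_zero, if_false]
    field_simp
    simp [pow_succ]
    ring

/-- The coefficients of 1/(a - t) are positive, so the seminorm is a truncation of its series at t =
1/4. -/
theorem nrm_recip_le (J n : ℕ) : nrm J (recip (n + 1)) ≤ 1 / ((n : ℝ) + 3 / 4) := by
  have h : nrm J (recip (n + 1)) =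
      1 / ((n : ℝ) + 1) * ∑ j ∈ range (J + 1), (1 / (4 * ((n : ℝ) + 1))) ^ j := by
    rw [nrm, mul_sum]
    refine sum_congr rfl fun j _ => ?_
    rw [recip, PowerSeries.coeff_mk, norm_div, norm_pow, norm_one, Complex.norm_natCast]
    push_cast
    rw [div_pow, div_pow, mul_pow, pow_succ]
    field_simp
  have hn : (0 : ℝ) ≤ n := Nat.cast_nonneg n
  have h1 : 1 / (4 * ((n : ℝ) + 1)) < 1 := by
    rw [div_lt_one (by positivity)]; linarith
  have h2 : ∑ j ∈ range (J + 1), (1 / (4 * ((n : ℝ) + 1))) ^ j ≤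
      (1 - 1 / (4 * ((n : ℝ) + 1)))⁻¹ := by
    rw [← tsum_geometric_of_lt_one (by positivity) h1]
    exact (summable_geometric_of_lt_one (by positivity) h1).sum_le_tsum _
      fun i _ => by positivity
  rw [h]
  calc _ ≤ 1 / ((n : ℝ) + 1) * (1 - 1 / (4 * ((n : ℝ) + 1)))⁻¹ := by gcongr
    _ = _ := by
      rw [one_div, ← mul_inv, one_div]
      have h3 : ((n : ℝ) + 1) * (4 * ((n : ℝ) + 1))⁻¹ = 1 / 4 := by field_simp
      rw [mul_sub, mul_one, one_div, h3, one_div]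
      ring

theorem nrm_natCast_sub_X_le (J n : ℕ) :
    nrm J ((n : ℂ⟦X⟧) - PowerSeries.X) ≤ n + 1 / 4 := by
  rw [sub_eq_add_neg]
  refine (nrm_add_le _ _ _).trans ?_
  rw [nrm_natCast, nrm_neg]
  gcongr
  exact nrm_X_le J

/-! ### Real majorants -/

section Majorants

/-- The real numbers `1 / (a - 1/4)`. -/
noncomputable def rr (a : ℕ) : ℝ := ((a : ℝ) - 1 / 4)⁻¹

theorem rr_succ (n : ℕ) : rr (n + 1) = 1 / ((n : ℝ) + 3 / 4) := by
  rw [rr, one_div]; push_cast; ring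

theorem rr_succ_pos (n : ℕ) : 0 < rr (n + 1) := by
  rw [rr_succ]; positivity

theorem sub_mul_rr (n : ℕ) : (((n + 1 : ℕ) : ℝ) - 1 / 4) * rr (n + 1) = 1 := by
  have : (0 : ℝ) ≤ n := Nat.cast_nonneg n
  rw [rr]
  exact mul_inv_cancel₀ (by push_cast; linarith)

/-- The product `∏_{j=1}^n j / (j - 1/4)`. -/
noncomputable def hh (n : ℕ) : ℝ := ∏ j ∈ range n, (((j + 1 : ℕ) : ℝ) * rr (j + 1))

/-- The product `∏_{j=1}^n (j - 1/2) / j`. -/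
noncomputable def psi (n : ℕ) : ℝ := ∏ j ∈ range n, (((j : ℝ) + 1 / 2) / ((j : ℝ) + 1))

/-- The product `∏_{j=1}^n (j - 1/2) / (j - 1/4)`. -/
noncomputable def phi (n : ℕ) : ℝ := hh n * psi n

theorem hh_succ (n : ℕ) : hh (n + 1) = hh n * (((n + 1 : ℕ) : ℝ) * rr (n + 1)) :=
  prod_range_succ _ _

theorem psi_succ (n : ℕ) : psi (n + 1) = psi n * (((n : ℝ) + 1 / 2) / ((n : ℝ) + 1)) :=
  prod_range_succ _ _

theorem hh_pos (n : ℕ) : 0 < hh n :=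
  prod_pos fun j _ => mul_pos (Nat.cast_pos.2 j.succ_pos) (rr_succ_pos j)

theorem psi_pos (n : ℕ) : 0 < psi n := prod_pos fun j _ => by positivity

theorem phi_pos (n : ℕ) : 0 < phi n := mul_pos (hh_pos n) (psi_pos n)

theorem phi_zero : phi 0 = 1 := by simp [phi, hh, psi]

theorem hh_succ_div (n : ℕ) : hh (n + 1) / ((n + 1 : ℕ) : ℝ) = hh n / ((n : ℝ) + 3 / 4) := by
  rw [hh_succ, rr_succ]
  field_simp

/-- Telescoping: 2(b+1) psi (b+1) = (2b+1) psi b. The exact closed form is what lets `phi` reproduce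
itself in `row_mul_le`. -/
theorem sum_psi (b : ℕ) : ∑ n ∈ range b, psi n = 2 * b * psi b := by
  induction b with
  | zero => simp
  | succ b ih =>
    rw [sum_range_succ, ih, psi_succ]
    push_cast
    field_simp

theorem phi_sub_phi_succ (n : ℕ) : phi n - phi (n + 1) = 1 / 4 * (phi n / ((n : ℝ) + 3 / 4)) := by
  rw [phi, phi, hh_succ, psi_succ, rr_succ]
  push_cast
  field_simp
  ring

theorem summable_phi_div_add : Summable fun n => phi n / ((n : ℝ) + 3 / 4) := by
  refine summable_of_sum_range_le (c := 4) (fun n => by have := phi_pos n; positivity) fun N => ?_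
  have h : ∀ n, phi n / ((n : ℝ) + 3 / 4) = 4 * (phi n - phi (n + 1)) := fun n => by
    rw [phi_sub_phi_succ]; ring
  simp only [h]
  rw [← mul_sum, sum_range_sub', phi_zero]
  linarith [phi_pos N]

theorem summable_phi_div : Summable fun n => phi n / (n : ℝ) := by
  refine Summable.of_nonneg_of_le (fun n => by have := phi_pos n; positivity) (fun n => ?_)
    (summable_phi_div_add.mul_left 2)
  have h0 := phi_pos n
  rcases Nat.eq_zero_or_pos n with rfl | hn
  · simp; positivity
  · have hn' : (1 : ℝ) ≤ n := by exact_mod_cast hn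
    rw [div_le_iff₀ (by positivity)]
    have : 2 * (phi n / ((n : ℝ) + 3 / 4)) * n = phi n * (2 * n / (n + 3 / 4)) := by ring
    rw [this]
    refine le_mul_of_one_le_right h0.le ?_
    rw [one_le_div (by positivity)]
    linarith

/-- The diagonal majorant kernel. -/
noncomputable def kd (m a : ℕ) : ℝ := if m = a then 1 / (a : ℝ) else 0

/-- The strictly upper triangular majorant kernels. -/
noncomputable def kup (ρ : ℝ) (m a : ℕ) : ℝ :=
  if m < a then ρ ^ (a - m) * (hh a / (a * hh m)) else 0

/-- The kernels that are bounded by `kd` or by `kup ρ`. -/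
def KernelBound (ρ : ℝ) (κ : ℕ → ℕ → ℝ) : Prop :=
  (∀ m a, κ m a ≤ kd m a) ∨ (∀ m a, κ m a ≤ kup ρ m a)

theorem kd_nonneg (m a : ℕ) : 0 ≤ kd m a := by unfold kd; positivity

theorem kup_nonneg {ρ : ℝ} (hρ : 0 ≤ ρ) (m a : ℕ) : 0 ≤ kup ρ m a := by
  have := hh_pos a
  have := hh_pos m
  unfold kup; positivity

theorem kup_mono {ρ ρ' : ℝ} (hρ : 0 ≤ ρ) (h : ρ ≤ ρ') (m a : ℕ) : kup ρ m a ≤ kup ρ' m a := by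
  have := hh_pos a
  have := hh_pos m
  unfold kup
  split_ifs
  · gcongr
  · exact le_rfl

/-- After the first step, an equality, each step multiplies hh a / a by a/(a + 3/4). This removes
`hh` from `kup` and leaves a geometric series in a. -/
theorem hh_div_antitone {m a : ℕ} (h : m < a) : hh a / a ≤ hh m / ((m : ℝ) + 3 / 4) := by
  induction a, h using Nat.le_induction with
  | base => exact (hh_succ_div m).le
  | succ a ha ih =>
    refine le_trans ?_ ih
    rw [hh_succ_div]
    have h1 : (0 : ℝ) < a := Nat.cast_pos.2 (by omega)
    have := hh_pos a
    gcongr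
    linarith

theorem hh_mono {m n : ℕ} (h : m ≤ n) : hh m ≤ hh n := by
  induction n, h using Nat.le_induction with
  | base => exact le_rfl
  | succ n hn ih =>
    refine ih.trans ?_
    rw [hh_succ, rr_succ]
    refine le_mul_of_one_le_right (hh_pos n).le ?_
    rw [mul_one_div, one_le_div (by positivity)]
    push_cast; linarith

theorem kup_le {ρ : ℝ} (hρ : 0 ≤ ρ) {m a : ℕ} (h : m < a) :
    kup ρ m a ≤ ρ ^ (a - m) * (1 / ((m : ℝ) + 3 / 4)) := by
  rw [kup, if_pos h]
  have h1 := hh_div_antitone h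
  have h2 := hh_pos m
  refine mul_le_mul_of_nonneg_left ?_ (by positivity)
  calc hh a / (a * hh m) = hh a / a / hh m := by rw [div_div]
    _ ≤ hh m / ((m : ℝ) + 3 / 4) / hh m := by gcongr
    _ = _ := by field_simp

/-- The majorant `kup` is wasteful for e_z; its extra factor is there for the product in `kerT`, so
that one bound serves both sides of the duality. -/
theorem rr_le_kup {ρ : ℝ} (hρ : 0 ≤ ρ) {m a : ℕ} (h : m < a) :
    ρ ^ (a - m) * rr a ≤ kup ρ m a := by
  obtain ⟨a, rfl⟩ : ∃ b, a = b + 1 := ⟨a - 1, by omega⟩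
  rw [kup, if_pos h]
  have h2 := hh_pos m
  have h3 := hh_mono (show m ≤ a by omega)
  gcongr
  rw [← div_div, hh_succ_div, rr_succ, div_right_comm]
  gcongr
  rwa [one_le_div h2]

theorem summable_kup {ρ : ℝ} (hρ : 0 ≤ ρ) (h1 : ρ < 1) (m : ℕ) : Summable (kup ρ m) ∧
    ∑' a, kup ρ m a ≤ (1 - ρ)⁻¹ * (1 / ((m : ℝ) + 3 / 4)) := by
  have h : HasSum (fun a => if m ≤ a then ρ ^ (a - m) * (1 / ((m : ℝ) + 3 / 4)) else 0)
      ((1 - ρ)⁻¹ * (1 / ((m : ℝ) + 3 / 4))) := by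
    rw [← hasSum_nat_add_iff' m]
    have : ∑ i ∈ range m, (if m ≤ i then ρ ^ (i - m) * (1 / ((m : ℝ) + 3 / 4)) else 0) = 0 :=
      sum_eq_zero fun i hi => if_neg (by simpa using hi)
    rw [this, sub_zero]
    simpa using (hasSum_geometric_of_lt_one hρ h1).mul_right (1 / ((m : ℝ) + 3 / 4))
  have hle : ∀ a, kup ρ m a ≤ if m ≤ a then ρ ^ (a - m) * (1 / ((m : ℝ) + 3 / 4)) else 0 := by
    intro a
    by_cases ha : m < a
    · rw [if_pos ha.le]; exact kup_le hρ ha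
    · rw [kup, if_neg ha]; positivity
  have hs := Summable.of_nonneg_of_le (kup_nonneg hρ m) hle h.summable
  exact ⟨hs, (hs.tsum_le_tsum hle h.summable).trans h.tsum_eq.le⟩

variable {p : ℕ → ℝ} {κ : ℕ → ℕ → ℝ} {K : ℝ}

/-- In the triangular case phi m * kup 1 m a = (hh a / a) * psi m for m < a, and `sum_psi` sums this
to 2 phi a. Thus domination by a multiple of `phi` survives every further letter. -/
theorem row_mul_le (hp : ∀ m, 0 ≤ p m) (hpK : ∀ m, p m ≤ K * phi m) (hκ : KernelBound 1 κ) (a : ℕ) :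
    ∑ m ∈ range (a + 1), p m * κ m a ≤ 2 * K * phi a := by
  have hK : 0 ≤ K := by simpa [phi_zero] using (hp 0).trans (hpK 0)
  have hφ := phi_pos a
  rcases hκ with h | h
  · calc _ ≤ ∑ m ∈ range (a + 1), p m * kd m a :=
        sum_le_sum fun m _ => mul_le_mul_of_nonneg_left (h m a) (hp m)
      _ = p a * (1 / a) := by simp [kd]
      _ ≤ p a := mul_le_of_le_one_right (hp a) (by
          rcases Nat.eq_zero_or_pos a with rfl | ha
          · simp
          · exact (div_le_one (by positivity)).2 (by exact_mod_cast ha))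
      _ ≤ K * phi a := hpK a
      _ ≤ _ := by nlinarith [mul_nonneg hK hφ.le]
  · calc _ ≤ ∑ m ∈ range (a + 1), (K * phi m) * kup 1 m a :=
        sum_le_sum fun m _ => (mul_le_mul_of_nonneg_left (h m a) (hp m)).trans
          (mul_le_mul_of_nonneg_right (hpK m) (kup_nonneg zero_le_one m a))
      _ = ∑ m ∈ range a, K * (hh a / a) * psi m := by
        rw [sum_range_succ, kup, if_neg (lt_irrefl a), mul_zero, add_zero]
        refine sum_congr rfl fun m hm => ?_
        rw [kup, if_pos (mem_range.1 hm), phi, one_pow]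
        have := hh_pos m
        field_simp
      _ = 2 * K * (hh a * psi a) * (a / a) := by
        rw [← mul_sum, sum_psi]; ring
      _ ≤ 2 * K * phi a := by
        rw [phi]
        -- For a = 0 the quotient a / a is 0, so it is only bounded by 1.
        refine mul_le_of_le_one_right ?_ (div_self_le_one _)
        have := hh_pos a
        have := psi_pos a
        positivity

theorem kernelBound_eq_zero (hκ0 : ∀ m a, 0 ≤ κ m a) {ρ : ℝ} (hκ : KernelBound ρ κ) {m a : ℕ}
    (h : ¬ m ≤ a) : κ m a = 0 := by
  refine le_antisymm ?_ (hκ0 m a)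
  rcases hκ with h' | h'
  · exact (h' m a).trans (by rw [kd, if_neg (by omega)])
  · exact (h' m a).trans (by rw [kup, if_neg (by omega)])

/-- On the diagonal the bound at 0 is 1/0 = 0. Hence the row of a nonempty word vanishes at 0. -/
theorem kernelBound_zero_zero {ρ : ℝ} (hκ : KernelBound ρ κ) : κ 0 0 ≤ 0 := by
  rcases hκ with h | h
  · simpa [kd] using h 0 0
  · simpa [kup] using h 0 0

/-- The decay must come from the kernel itself, being diagonal or having ρ < 1. In both cases
summing over a costs a factor of order 1/m, and phi m / m is summable. -/
theorem summable_row_mul (hp : ∀ m, 0 ≤ p m) (hpK : ∀ m, p m ≤ K * phi m)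
    (hκ0 : ∀ m a, 0 ≤ κ m a) {ρ : ℝ} (hρ : 0 ≤ ρ) (hρ1 : ρ < 1) (hκ : KernelBound ρ κ) :
    Summable fun x : ℕ × ℕ => p x.1 * κ x.1 x.2 := by
  have hK : 0 ≤ K := by simpa [phi_zero] using (hp 0).trans (hpK 0)
  have key : ∀ (μ : ℕ → ℕ → ℝ) (M : ℝ) (w : ℕ → ℝ), (∀ m a, 0 ≤ μ m a) → (∀ m, Summable (μ m)) →
      (∀ m, ∑' a, μ m a ≤ M * w m) → (Summable fun m => phi m * w m) → (∀ m a, κ m a ≤ μ m a) →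
      Summable fun x : ℕ × ℕ => p x.1 * κ x.1 x.2 := by
    intro μ M w h0 hs hle hw hκμ
    have h1 : Summable fun x : ℕ × ℕ => phi x.1 * μ x.1 x.2 := by
      rw [summable_prod_of_nonneg fun x => mul_nonneg (phi_pos x.1).le (h0 x.1 x.2)]
      refine ⟨fun m => (hs m).mul_left (phi m), ?_⟩
      refine Summable.of_nonneg_of_le (fun m => tsum_nonneg fun a =>
        mul_nonneg (phi_pos m).le (h0 m a)) (fun m => ?_) (hw.mul_left M)
      simp only [tsum_mul_left]
      calc phi m * ∑' a, μ m a ≤ phi m * (M * w m) := mul_le_mul_of_nonneg_left (hle m) (phi_pos m).le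
        _ = _ := by ring
    refine Summable.of_nonneg_of_le (fun x => mul_nonneg (hp x.1) (hκ0 x.1 x.2)) (fun x => ?_)
      (h1.mul_left K)
    rw [← mul_assoc]
    exact mul_le_mul (hpK x.1) (hκμ x.1 x.2) (hκ0 x.1 x.2) (mul_nonneg hK (phi_pos x.1).le)
  rcases hκ with h | h
  · have hs : ∀ m, HasSum (kd m) (1 / (m : ℝ)) := fun m => by
      have := hasSum_single (f := kd m) m fun a ha => if_neg (Ne.symm ha)
      simpa [kd] using this
    exact key kd 1 (fun m => 1 / (m : ℝ)) kd_nonneg (fun m => (hs m).summable)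
      (fun m => by rw [(hs m).tsum_eq, one_mul])
      (by simpa only [mul_one_div] using summable_phi_div) h
  · exact key (kup ρ) (1 - ρ)⁻¹ (fun m => 1 / ((m : ℝ) + 3 / 4)) (kup_nonneg hρ)
      (fun m => (summable_kup hρ hρ1 m).1) (fun m => (summable_kup hρ hρ1 m).2)
      (by simpa only [mul_one_div] using summable_phi_div_add) h

/-- With the extra 1/a even ρ = 1 is allowed: summing over m first leaves at most 2K phi a / a. -/
theorem summable_row_mul_div (hp : ∀ m, 0 ≤ p m) (hpK : ∀ m, p m ≤ K * phi m)
    (hκ0 : ∀ m a, 0 ≤ κ m a) (hκ : KernelBound 1 κ) :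
    Summable fun x : ℕ × ℕ => p x.1 * κ x.1 x.2 / (x.2 : ℝ) := by
  have hz : ∀ a, ∀ m ∉ range (a + 1), p m * κ m a / (a : ℝ) = 0 := fun a m hm => by
    rw [kernelBound_eq_zero hκ0 hκ (by simpa using hm)]; simp
  have h1 : Summable fun x : ℕ × ℕ => p x.2 * κ x.2 x.1 / (x.1 : ℝ) := by
    rw [summable_prod_of_nonneg fun x =>
      div_nonneg (mul_nonneg (hp _) (hκ0 _ _)) (Nat.cast_nonneg _)]
    refine ⟨fun a => summable_of_ne_finset_zero (s := range (a + 1)) (hz a), ?_⟩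
    refine Summable.of_nonneg_of_le (fun a => tsum_nonneg fun m =>
      div_nonneg (mul_nonneg (hp _) (hκ0 _ _)) (Nat.cast_nonneg _)) (fun a => ?_)
      (summable_phi_div.mul_left (2 * K))
    rw [tsum_eq_sum (hz a), ← sum_div, ← mul_div_assoc]
    gcongr
    exact row_mul_le hp hpK hκ a
  exact h1.prod_symm

end Majorants

/-! ### Real beta values -/

section RealBeta

/-- The beta values for `t = 1/4`. -/
noncomputable def betR (m n : ℕ) : ℝ := bet (1 / 4 : ℝ) rr m n

theorem fac_mul_rfac_add {S : Type*} [CommRing S] {t : S} {r : ℕ → S}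
    (h : ∀ n : ℕ, (((n + 1 : ℕ) : S) - t) * r (n + 1) = 1) (m k : ℕ) :
    fac t m * rfac r (m + k) = ∏ j ∈ range k, r (m + j + 1) := by
  induction k with
  | zero => simpa using fac_mul_rfac h m
  | succ k ih => rw [← add_assoc, rfac_succ, ← mul_assoc, ih, prod_range_succ]

theorem betR_eq (m n : ℕ) : betR m n = n.factorial * ∏ j ∈ range (n + 1), rr (m + j + 1) := by
  rw [betR, bet, mul_assoc, add_assoc, fac_mul_rfac_add sub_mul_rr]

theorem betR_pos (m n : ℕ) : 0 < betR m n := by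
  rw [betR_eq]
  exact mul_pos (Nat.cast_pos.2 n.factorial_pos) (prod_pos fun j _ => rr_succ_pos _)

theorem betR_pascal (m n : ℕ) : betR m n = betR (m + 1) n + betR m (n + 1) :=
  bet_pascal sub_mul_rr m n

theorem betR_le_zero_left (m n : ℕ) : betR m n ≤ betR 0 n := by
  induction m with
  | zero => exact le_rfl
  | succ m ih => linarith [betR_pascal m n, betR_pos m (n + 1)]

theorem betR_le_add (m n k : ℕ) : betR m (n + k) ≤ betR m n := by
  induction k with
  | zero => exact le_rfl
  | succ k ih => rw [← add_assoc]; linarith [betR_pascal m (n + k), betR_pos (m + 1) (n + k)]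

theorem betR_zero_right (m : ℕ) : betR m 0 = 1 / ((m : ℝ) + 3 / 4) := by
  rw [betR, bet_zero_right sub_mul_rr, rr_succ]

theorem tendsto_betR_right (m : ℕ) : Tendsto (betR m) atTop (𝓝 0) := by
  -- The recursion multiplies `betR 0 n` by (n+1)/(n+7/4), whose square is at most (n+1)/(n+2); 16/9
  -- is the value at n = 0.
  have h : ∀ n : ℕ, betR 0 n ^ 2 * ((n : ℝ) + 1) ≤ 16 / 9 := by
    intro n
    induction n with
    | zero => rw [betR_zero_right]; norm_num
    | succ n ih =>
      refine le_trans ?_ ih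
      rw [betR, bet_zero_left_succ, ← betR, mul_pow, mul_assoc, rr_succ]
      gcongr
      push_cast
      rw [mul_one_div, div_pow, div_mul_eq_mul_div, div_le_iff₀ (by positivity)]
      nlinarith [sq_nonneg (n : ℝ), (Nat.cast_nonneg n : (0 : ℝ) ≤ n)]
  have h0 : Tendsto (fun n => betR 0 n ^ 2) atTop (𝓝 0) := by
    refine squeeze_zero (fun n => sq_nonneg _) (fun n => (le_div_iff₀ (by positivity)).2 (h n)) ?_
    simpa [div_eq_mul_inv] using
      (tendsto_one_div_add_atTop_nhds_zero_nat (𝕜 := ℝ)).const_mul (16 / 9 : ℝ)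
  have h1 : Tendsto (betR 0) atTop (𝓝 0) := by
    have := h0.sqrt
    simpa [Real.sqrt_sq (betR_pos 0 _).le] using this
  exact squeeze_zero (fun n => (betR_pos m n).le) (betR_le_zero_left m) h1

theorem tendsto_betR_left (n : ℕ) : Tendsto (fun m => betR m n) atTop (𝓝 0) := by
  refine squeeze_zero (fun m => (betR_pos m n).le) (g := fun m : ℕ => 1 / ((m : ℝ) + 3 / 4))
    (fun m => ?_) ?_
  · rw [← betR_zero_right]
    simpa using betR_le_add m 0 n
  · have := tendsto_atTop_add_const_right atTop (3 / 4 : ℝ) (tendsto_natCast_atTop_atTop (R := ℝ))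
    simp only [one_div]
    exact this.inv_tendsto_atTop

theorem hasSum_betR_left (m n : ℕ) : HasSum (fun a => betR (m + a) (n + 1)) (betR m n) := by
  rw [hasSum_iff_tendsto_nat_of_nonneg fun a => (betR_pos _ _).le]
  have h : ∀ N, ∑ a ∈ range N, betR (m + a) (n + 1) = betR m n - betR (N + m) n := by
    intro N
    have : ∀ a, betR (m + a) (n + 1) = betR (m + a) n - betR (m + (a + 1)) n := fun a => by
      rw [betR_pascal (m + a) n]; ring_nf
    simp only [this]
    rw [sum_range_sub' fun a => betR (m + a) n, add_zero, add_comm m]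
  simp only [h]
  simpa using ((tendsto_add_atTop_iff_nat m).2 (tendsto_betR_left n)).const_sub (betR m n)

theorem hasSum_betR_right (m n : ℕ) : HasSum (fun b => betR (m + 1) (n + b)) (betR m n) := by
  rw [hasSum_iff_tendsto_nat_of_nonneg fun a => (betR_pos _ _).le]
  have h : ∀ N, ∑ b ∈ range N, betR (m + 1) (n + b) = betR m n - betR m (N + n) := by
    intro N
    have : ∀ b, betR (m + 1) (n + b) = betR m (n + b) - betR m (n + (b + 1)) := fun b => by
      rw [betR_pascal m (n + b)]; ring_nf
    simp only [this]
    rw [sum_range_sub' fun b => betR m (n + b), add_zero, add_comm n]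
  simp only [h]
  simpa using ((tendsto_add_atTop_iff_nat n).2 (tendsto_betR_right m)).const_sub (betR m n)

theorem nrm_recip_le_rr (J n : ℕ) : nrm J (recip (n + 1)) ≤ rr (n + 1) := by
  rw [rr_succ]; exact nrm_recip_le J n

/-- The beta values in `ℂ⟦t⟧`. -/
noncomputable def betX (m n : ℕ) : ℂ⟦X⟧ := bet PowerSeries.X recip m n

theorem betX_pascal (m n : ℕ) : betX m n = betX (m + 1) n + betX m (n + 1) :=
  bet_pascal sub_X_mul_recip m n

theorem nrm_betX_le (J m n : ℕ) : nrm J (betX m n) ≤ betR m n := by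
  rw [betR_eq, betX, bet, mul_assoc, add_assoc, fac_mul_rfac_add sub_X_mul_recip]
  refine (nrm_mul_le _ _ _).trans ?_
  rw [nrm_natCast]
  gcongr
  exact nrm_prod_le _ _ _ _ fun j _ => nrm_recip_le_rr _ _

/-- The connector in `ℂ⟦t⟧`. -/
noncomputable def connX (m n : ℕ) : ℂ⟦X⟧ := conn PowerSeries.X recip m n

/-- The quotient (m+1-t)/(m+n+1-t) has seminorm at most (m+5/4)/(m+n+3/4), which is below 1 as soon
as n ≥ 1. -/
theorem nrm_connX_succ_left_le (J m n : ℕ) (hn : 1 ≤ n) :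
    nrm J (connX (m + 1) n) ≤ nrm J (connX m n) := by
  rw [connX, conn_succ_left]
  refine (nrm_mul_le _ _ _).trans (mul_le_of_le_one_right (nrm_nonneg _ _) ?_)
  refine (nrm_mul_le _ _ _).trans ?_
  refine (mul_le_mul (nrm_natCast_sub_X_le J (m + 1)) (nrm_recip_le J (m + n)) (nrm_nonneg _ _)
    (by positivity)).trans ?_
  rw [mul_one_div, div_le_one (by positivity)]
  have : (1 : ℝ) ≤ n := by exact_mod_cast hn
  push_cast
  linarith

theorem nrm_connX_one_left_le (J n : ℕ) (hn : 1 ≤ n) : nrm J (connX 1 n) ≤ 2 / n := by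
  have hn' : (1 : ℝ) ≤ n := by exact_mod_cast hn
  have h := conn_succ_left (t := (PowerSeries.X : ℂ⟦X⟧)) (r := recip) 0 n
  rw [conn_comm, conn_comm _ _ 0, conn_zero_right sub_X_mul_recip, one_mul, zero_add,
    zero_add, conn_comm] at h
  rw [connX, h]
  refine (nrm_mul_le _ _ _).trans ?_
  refine (mul_le_mul (nrm_natCast_sub_X_le J 1) (nrm_recip_le J n) (nrm_nonneg _ _)
    (by positivity)).trans ?_
  rw [mul_one_div, div_le_div_iff₀ (by positivity) (by positivity)]
  push_cast
  linarith

theorem nrm_connX_two_left_le (J n : ℕ) (hn : 1 ≤ n) : nrm J (connX 2 n) ≤ 8 / n ^ 2 := by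
  have hn' : (1 : ℝ) ≤ n := by exact_mod_cast hn
  rw [connX, conn_succ_left]
  refine (nrm_mul_le _ _ _).trans ?_
  have h2 : nrm J (((1 + 1 : ℕ) : ℂ⟦X⟧) - PowerSeries.X) * nrm J (recip (1 + n + 1)) ≤ 4 / n := by
    refine (mul_le_mul (nrm_natCast_sub_X_le J 2) (nrm_recip_le J (1 + n)) (nrm_nonneg _ _)
      (by positivity)).trans ?_
    rw [mul_one_div, div_le_div_iff₀ (by positivity) (by positivity)]
    push_cast
    linarith
  calc _ ≤ (2 / (n : ℝ)) * (4 / n) := by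
        refine mul_le_mul (nrm_connX_one_left_le J n hn) ((nrm_mul_le _ _ _).trans h2)
          (nrm_nonneg _ _) (by positivity)
    _ = _ := by field_simp; norm_num

theorem nrm_connX_le_of_le (J : ℕ) {m₀ m n : ℕ} (h : m₀ ≤ m) (hn : 1 ≤ n) :
    nrm J (connX m n) ≤ nrm J (connX m₀ n) := by
  induction m, h using Nat.le_induction with
  | base => exact le_rfl
  | succ m _ ih => exact (nrm_connX_succ_left_le J m n hn).trans ih

/-- For m ≥ 2, monotonicity reduces to the bound 8/n² at m = 2, and n² ≥ mn. -/
theorem nrm_connX_le_aux (J m n : ℕ) (hm : 1 ≤ m) (hmn : m ≤ n) :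
    nrm J (connX m n) ≤ 8 / (m * n) := by
  have hm' : (1 : ℝ) ≤ m := by exact_mod_cast hm
  have hmn' : (m : ℝ) ≤ n := by exact_mod_cast hmn
  have hn' : (0 : ℝ) < n := by linarith
  rcases hm.eq_or_lt with rfl | h2
  · refine (nrm_connX_one_left_le J n hmn).trans ?_
    rw [Nat.cast_one, one_mul]
    gcongr
    norm_num
  · refine (nrm_connX_le_of_le J h2 (hm.trans hmn)).trans
      ((nrm_connX_two_left_le J n (hm.trans hmn)).trans ?_)
    rw [pow_two]
    gcongr

theorem nrm_connX_le (J m n : ℕ) (hm : 1 ≤ m) (hn : 1 ≤ n) :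
    nrm J (connX m n) ≤ 8 / (m * n) := by
  rcases le_total m n with h | h
  · exact nrm_connX_le_aux J m n hm h
  · rw [connX, conn_comm, ← connX, mul_comm]
    exact nrm_connX_le_aux J n m hn h

end RealBeta

/-! ### Summation in `ℂ⟦t⟧` -/

section Summation

variable {ι : Type*} {f : ι → ℂ⟦X⟧}

theorem summable_of_nrm (h : ∀ J, Summable fun i => nrm J (f i)) : Summable f := by
  rw [PowerSeries.WithPiTopology.summable_iff_summable_coeff]
  exact fun j => Summable.of_norm_bounded ((h j).mul_left (4 ^ j)) fun _ => norm_coeff_le j _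

theorem summable_of_nrm_le {g : ι → ℝ} (hg : Summable g) (h : ∀ J i, nrm J (f i) ≤ g i) :
    Summable f :=
  summable_of_nrm fun J => Summable.of_nonneg_of_le (fun _ => nrm_nonneg _ _) (h J) hg

theorem norm_coeff_hasSum_le {s : ℂ⟦X⟧} (hs : HasSum f s) {g : ι → ℝ} {G : ℝ} (hg : HasSum g G)
    (h : ∀ J i, nrm J (f i) ≤ g i) (j : ℕ) : ‖PowerSeries.coeff j s‖ ≤ 4 ^ j * G := by
  have h1 := PowerSeries.WithPiTopology.hasSum_iff_hasSum_coeff ℂ |>.1 hs j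
  rw [← h1.tsum_eq]
  refine tsum_of_norm_bounded (hg.mul_left (4 ^ j)) fun i => (norm_coeff_le j (f i)).trans ?_
  gcongr
  exact h j i

theorem tendsto_zero_of_norm_coeff_le {u : ℕ → ℂ⟦X⟧} {g : ℕ → ℝ} (hg : Tendsto g atTop (𝓝 0))
    (h : ∀ j n, ‖PowerSeries.coeff j (u n)‖ ≤ 4 ^ j * g n) : Tendsto u atTop (𝓝 0) := by
  rw [PowerSeries.WithPiTopology.tendsto_iff_coeff_tendsto]
  intro j
  rw [map_zero]
  exact squeeze_zero_norm (h j) (by simpa using hg.const_mul ((4 : ℝ) ^ j))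

end Summation

/-! ### The transport relations -/

section Transport

open PowerSeries (C)

theorem nrm_C_pow_mul_betX_le (J : ℕ) (z : ℂ) (k m n : ℕ) :
    nrm J (C z ^ k * betX m n) ≤ ‖z‖ ^ k * betR m n := by
  rw [← map_pow]
  refine (nrm_mul_le _ _ _).trans ?_
  rw [nrm_C, norm_pow]
  gcongr
  exact nrm_betX_le _ _ _

theorem summable_geometric_bound {z : ℂ} (hz : ‖z‖ < 1) (c : ℝ) :
    Summable fun a : ℕ => ‖z‖ ^ (a + 1) * c :=
  (((summable_geometric_of_lt_one (norm_nonneg z) hz).mul_left ‖z‖).congr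
    fun a => by rw [pow_succ']).mul_right c

theorem summable_betX_left {z : ℂ} (hz : ‖z‖ ≤ 1) {m n : ℕ} (h : ‖z‖ < 1 ∨ 1 ≤ n) :
    Summable fun a => C z ^ (a + 1) * betX (m + a) n := by
  rcases h with h | h
  · refine summable_of_nrm_le (summable_geometric_bound h (betR 0 n)) fun J a => ?_
    refine (nrm_C_pow_mul_betX_le _ _ _ _ _).trans ?_
    gcongr
    exact betR_le_zero_left _ _
  · obtain ⟨n, rfl⟩ : ∃ k, n = k + 1 := ⟨n - 1, by omega⟩
    refine summable_of_nrm_le (hasSum_betR_left m n).summable fun J a => ?_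
    exact (nrm_C_pow_mul_betX_le _ _ _ _ _).trans
      (mul_le_of_le_one_left (betR_pos _ _).le (pow_le_one₀ (norm_nonneg _) hz))

theorem summable_betX_right {z : ℂ} (hz : ‖z‖ ≤ 1) {m n : ℕ} (h : ‖z‖ < 1 ∨ 1 ≤ m) :
    Summable fun b => C z ^ (b + 1) * betX m (n + b) := by
  rcases h with h | h
  · refine summable_of_nrm_le (summable_geometric_bound h (betR m n)) fun J a => ?_
    refine (nrm_C_pow_mul_betX_le _ _ _ _ _).trans ?_
    gcongr
    exact betR_le_add _ _ _
  · obtain ⟨m, rfl⟩ : ∃ k, m = k + 1 := ⟨m - 1, by omega⟩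
    refine summable_of_nrm_le (hasSum_betR_right m n).summable fun J a => ?_
    exact (nrm_C_pow_mul_betX_le _ _ _ _ _).trans
      (mul_le_of_le_one_left (betR_pos _ _).le (pow_le_one₀ (norm_nonneg _) hz))

/-- Write S_n for the left side and B for `betX`. Pascal's rule gives z(S_n - S_{n+1}) = S_n - z
B(m, n); solve for S_n. Division by z - 1 is legitimate, since z = 1 would turn the relation between
w and z into 0 = 1. -/
theorem tsum_betX_left {z w : ℂ} (hw : w * (z - 1) = z) (hz : ‖z‖ ≤ 1) {m n : ℕ}
    (h : ‖z‖ < 1 ∨ 1 ≤ n) :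
    ∑' a, C z ^ (a + 1) * betX (m + a) n =
      -(C w * betX m n) + C w * ∑' a, C z ^ (a + 1) * betX (m + a) (n + 1) := by
  have h0 := summable_betX_left (m := m) hz h
  have h1 := summable_betX_left (m := m) (n := n + 1) hz (Or.inr (by omega))
  have h2 := h0.hasSum
  rw [← hasSum_nat_add_iff' 1] at h2
  have h3 := (h0.hasSum.sub h1.hasSum).mul_left (C z)
  have h4 := h2.unique (h3.congr_fun ?_)
  · simp only [range_one, sum_singleton, zero_add, pow_one, add_zero] at h4
    have hz1 : z - 1 ≠ 0 := by
      intro h5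
      rw [h5, mul_zero] at hw
      rw [← hw] at h5
      norm_num at h5
    have hC : (C (z - 1) : ℂ⟦X⟧) ≠ 0 := by
      rwa [Ne, map_eq_zero_iff _ PowerSeries.C_injective]
    refine mul_left_cancel₀ hC ?_
    have hw' : (C w : ℂ⟦X⟧) * C (z - 1) = C z := by rw [← map_mul, hw]
    have hz' : (C (z - 1) : ℂ⟦X⟧) = C z - 1 := by rw [map_sub, map_one]
    linear_combination -h4 + (betX m n - ∑' a, C z ^ (a + 1) * betX (m + a) (n + 1)) * hw' +
      (∑' a, C z ^ (a + 1) * betX (m + a) n) * hz'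
  · intro a
    rw [← add_assoc, betX_pascal (m + a) n]
    ring

/-- Iterating `tsum_betX_left` makes the N-th partial sum w^N S_{n+N} - S_n. The remainder tends to
0 even for |w| = 1, because S_{n+N} itself does. -/
theorem hasSum_betX_right {z w : ℂ} (hw : w * (z - 1) = z) (hz : ‖z‖ ≤ 1) (hw1 : ‖w‖ ≤ 1) {m n : ℕ}
    (hm : ‖w‖ < 1 ∨ 1 ≤ m) (hn : ‖z‖ < 1 ∨ 1 ≤ n) :
    HasSum (fun b => C w ^ (b + 1) * betX m (n + b))
      (-∑' a, C z ^ (a + 1) * betX (m + a) n) := by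
  rw [(summable_betX_right hw1 hm).hasSum_iff_tendsto_nat]
  have h : ∀ N, ∑ b ∈ range N, C w ^ (b + 1) * betX m (n + b) =
      C w ^ N * (∑' a, C z ^ (a + 1) * betX (m + a) (n + N)) -
        ∑' a, C z ^ (a + 1) * betX (m + a) n := by
    intro N
    induction N with
    | zero => simp
    | succ N ih =>
      rw [sum_range_succ, ih,
        tsum_betX_left (n := n + N) hw hz (hn.imp_right fun h => h.trans (Nat.le_add_right _ _)),
        add_assoc n N 1]
      ring
  simp only [h]
  rw [← zero_sub]
  refine Tendsto.sub_const ?_ _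
  -- The shift makes the second beta index a successor, as the majorant `hasSum_betR_left` requires.
  rw [← tendsto_add_atTop_iff_nat 1]
  refine tendsto_zero_of_norm_coeff_le
    ((tendsto_add_atTop_iff_nat n).2 (tendsto_betR_right m)) fun j N => ?_
  have h1 := ((summable_betX_left (m := m) (n := n + (N + 1)) hz (Or.inr (by omega))).hasSum).mul_left
    (C w ^ (N + 1))
  rw [add_comm N n]
  refine norm_coeff_hasSum_le h1 (hasSum_betR_left m (n + N)) (fun J a => ?_) j
  rw [← map_pow]
  refine (nrm_mul_le _ _ _).trans ?_
  rw [nrm_C, norm_pow, ← add_assoc]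
  refine (mul_le_of_le_one_left (nrm_nonneg _ _) (pow_le_one₀ (norm_nonneg _) hw1)).trans ?_
  exact (nrm_C_pow_mul_betX_le _ _ _ _ _).trans
      (mul_le_of_le_one_left (betR_pos _ _).le (pow_le_one₀ (norm_nonneg _) hz))

/-- This covers z = 1, where z/(z - 1) is not available: Pascal's rule telescopes directly. -/
theorem hasSum_betX_left_one (m n : ℕ) :
    HasSum (fun a => betX (m + a) (n + 1)) (betX m n) := by
  have hs : Summable fun a => betX (m + a) (n + 1) :=
    summable_of_nrm_le (hasSum_betR_left m n).summable fun J a => nrm_betX_le _ _ _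
  rw [hs.hasSum_iff_tendsto_nat]
  have h : ∀ N, ∑ a ∈ range N, betX (m + a) (n + 1) = betX m n - betX (N + m) n := by
    intro N
    have : ∀ a, betX (m + a) (n + 1) = betX (m + a) n - betX (m + (a + 1)) n := fun a => by
      rw [betX_pascal (m + a) n]; ring_nf
    simp only [this]
    rw [sum_range_sub' fun a => betX (m + a) n, add_zero, add_comm m]
  simp only [h]
  have h0 : Tendsto (fun N => betX (N + m) n) atTop (𝓝 0) :=
    tendsto_zero_of_norm_coeff_le ((tendsto_add_atTop_iff_nat m).2 (tendsto_betR_left n))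
      fun j N => (norm_coeff_le _ _).trans (by gcongr; exact nrm_betX_le _ _ _)
  simpa using h0.const_sub (betX m n)

/-- The kernel of `x`. -/
noncomputable def kerX (m a : ℕ) : ℂ⟦X⟧ := if m = a then C (1 / (a : ℂ)) else 0

/-- The kernel of `e_z (1 - x t)⁻¹`. -/
noncomputable def kerE (z : ℂ) (m a : ℕ) : ℂ⟦X⟧ :=
  if m < a then C z ^ (a - m) * recip a else 0

/-- The kernel of `-e_z (1 - x t - e_z t)⁻¹`. -/
noncomputable def kerT (z : ℂ) (m a : ℕ) : ℂ⟦X⟧ :=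
  if m < a then -(C z ^ (a - m) * recip a *
    ∏ i ∈ range (a - m - 1), (((m + i + 1 : ℕ) : ℂ⟦X⟧) * recip (m + i + 1))) else 0

/-- The transport relation between two kernels at the point `(m, n)`. -/
def Transports (K K' : ℕ → ℕ → ℂ⟦X⟧) (m n : ℕ) : Prop :=
  ∃ T, HasSum (fun a => K m a * connX a n) T ∧ HasSum (fun b => K' n b * connX m b) T

theorem Transports.symm {K K' : ℕ → ℕ → ℂ⟦X⟧} {m n : ℕ} (h : Transports K K' m n) :
    Transports K' K n m := by
  obtain ⟨T, h1, h2⟩ := h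
  refine ⟨T, ?_, ?_⟩
  · simpa only [connX, conn_comm _ _ n, conn_comm _ _ m] using h2
  · simpa only [connX, conn_comm _ _ n, conn_comm _ _ m] using h1

theorem hasSum_of_shift {f : ℕ → ℂ⟦X⟧} {s : ℂ⟦X⟧} (m : ℕ) (h0 : ∀ a, ¬ m < a → f a = 0)
    (h : HasSum (fun a => f (m + a + 1)) s) : HasSum f s := by
  rw [← hasSum_nat_add_iff' (m + 1), sum_eq_zero fun a ha => h0 a ?_, sub_zero]
  · exact h.congr_fun fun a => by ring_nf
  · have := mem_range.1 ha; omega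

theorem factorial_mul_C_inv (n : ℕ) :
    (C (1 / (n.factorial : ℂ)) : ℂ⟦X⟧) * (n.factorial : ℂ⟦X⟧) = 1 := by
  have h : (n.factorial : ℂ⟦X⟧) = C (n.factorial : ℂ) := by simp
  have h0 : (n.factorial : ℂ) ≠ 0 := Nat.cast_ne_zero.2 n.factorial_ne_zero
  rw [h, ← map_mul, one_div, inv_mul_cancel₀ h0, map_one]

theorem recip_mul_connX (a n : ℕ) :
    recip (a + 1) * connX (a + 1) n =
      C (1 / (n.factorial : ℂ)) * fac PowerSeries.X n * betX a n := by
  have h := mul_conn_eq_bet sub_X_mul_recip a n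
  rw [connX, betX, mul_assoc, ← h, ← mul_assoc, factorial_mul_C_inv, one_mul]

/-- The factors j - t and 1/(j - t) with n < j ≤ n + b cancel, and the integers j that remain
complete n! to (n+b)!. -/
theorem kerT_prod (n b : ℕ) :
    (n.factorial : ℂ⟦X⟧) * (fac PowerSeries.X (n + b) *
      ∏ i ∈ range b, (((n + i + 1 : ℕ) : ℂ⟦X⟧) * recip (n + i + 1))) =
      fac PowerSeries.X n * ((n + b).factorial : ℂ⟦X⟧) := by
  induction b with
  | zero => simp [mul_comm]
  | succ b ih =>
    rw [prod_range_succ, ← add_assoc, fac_succ, Nat.factorial_succ, Nat.cast_mul]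
    linear_combination ((n + b + 1 : ℕ) : ℂ⟦X⟧) * ih + ((n + b + 1 : ℕ) : ℂ⟦X⟧) *
      ((n.factorial : ℂ⟦X⟧) * (fac PowerSeries.X (n + b) *
      ∏ i ∈ range b, (((n + i + 1 : ℕ) : ℂ⟦X⟧) * recip (n + i + 1)))) * sub_X_mul_recip (n + b)

/-- Up to sign the prefactor is the one in `recip_mul_connX`, so transport reduces to
`hasSum_betX_right`. -/
theorem kerT_mul_connX (w : ℂ) (m n b : ℕ) :
    kerT w n (n + b + 1) * connX m (n + b + 1) =
      -(C (1 / (n.factorial : ℂ)) * fac PowerSeries.X n * (C w ^ (b + 1) * betX m (n + b))) := by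
  have h1 := factorial_mul_C_inv n
  have h2 := kerT_prod n b
  have h3 := sub_X_mul_recip (n + b)
  rw [kerT, if_pos (by omega), show n + b + 1 - n = b + 1 by omega, Nat.add_sub_cancel, connX, betX,
    conn, bet, fac_succ, ← add_assoc m (n + b) 1, ← add_assoc m n b]
  set P := ∏ i ∈ range b, (((n + i + 1 : ℕ) : ℂ⟦X⟧) * recip (n + i + 1))
  set G := rfac recip (m + n + b + 1)
  linear_combination (-(C w ^ (b + 1) * P * fac PowerSeries.X m * fac PowerSeries.X (n + b) * G)) * h3
    + (C w ^ (b + 1) * P * fac PowerSeries.X m * fac PowerSeries.X (n + b) * G) * h1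
    - (C w ^ (b + 1) * fac PowerSeries.X m * G * C (1 / (n.factorial : ℂ))) * h2

theorem transports_kerE_kerT {z w : ℂ} (hw : w * (z - 1) = z) (hz : ‖z‖ ≤ 1) (hw1 : ‖w‖ ≤ 1)
    {m n : ℕ} (hm : ‖w‖ < 1 ∨ 1 ≤ m) (hn : ‖z‖ < 1 ∨ 1 ≤ n) :
    Transports (kerE z) (kerT w) m n := by
  refine ⟨C (1 / (n.factorial : ℂ)) * fac PowerSeries.X n *
    ∑' a, C z ^ (a + 1) * betX (m + a) n, ?_, ?_⟩
  · refine hasSum_of_shift m (fun a ha => by rw [kerE, if_neg ha, zero_mul]) ?_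
    refine ((summable_betX_left hz hn).hasSum.mul_left _).congr_fun fun a => ?_
    rw [kerE, if_pos (by omega), mul_assoc, recip_mul_connX,
      show m + a + 1 - m = a + 1 by omega]
    ring
  · refine hasSum_of_shift n (fun a ha => by rw [kerT, if_neg ha, zero_mul]) ?_
    have := (hasSum_betX_right hw hz hw1 hm hn).mul_left
      (-(C (1 / (n.factorial : ℂ)) * fac PowerSeries.X n))
    rw [neg_mul_neg] at this
    refine this.congr_fun fun b => ?_
    rw [kerT_mul_connX, neg_mul]

/-- The telescoped series is C(m, n)/n, and 1/n is the diagonal entry for `x`. For n = 0 the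
connector is 1 and the series would diverge like the harmonic one. -/
theorem transports_kerE_one (m : ℕ) {n : ℕ} (hn : 1 ≤ n) : Transports (kerE 1) kerX m n := by
  obtain ⟨n, rfl⟩ : ∃ k, n = k + 1 := ⟨n - 1, by omega⟩
  refine ⟨C (1 / ((n + 1 : ℕ) : ℂ)) * connX m (n + 1), ?_, ?_⟩
  · refine hasSum_of_shift m (fun a ha => by rw [kerE, if_neg ha, zero_mul]) ?_
    have h1 := (hasSum_betX_left_one m n).mul_left
      (C (1 / ((n + 1).factorial : ℂ)) * fac PowerSeries.X (n + 1))
    have h2 : C (1 / ((n + 1).factorial : ℂ)) * fac PowerSeries.X (n + 1) * betX m n =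
        C (1 / ((n + 1 : ℕ) : ℂ)) * connX m (n + 1) := by
      have h3 := conn_eq_bet (t := (PowerSeries.X : ℂ⟦X⟧)) (r := recip) m n
      rw [mul_assoc, betX, ← h3, Nat.factorial_succ, Nat.cast_mul, one_div, mul_inv, map_mul,
        ← one_div, ← one_div]
      rw [← connX]
      linear_combination C (1 / ((n + 1 : ℕ) : ℂ)) * connX m (n + 1) * factorial_mul_C_inv n
    rw [h2] at h1
    refine h1.congr_fun fun a => ?_
    rw [kerE, if_pos (by omega), mul_assoc, recip_mul_connX, map_one, one_pow, one_mul]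
  · have h := hasSum_single (f := fun b => kerX (n + 1) b * connX m b) (n + 1) fun b hb => by
      rw [kerX, if_neg (Ne.symm hb), zero_mul]
    simpa [kerX] using h

end Transport

/-! ### Transport of rows -/

section Rows

/-- The kernels over `ℂ⟦t⟧` whose seminorms are bounded by `kd` or by `kup ρ`. -/
def KernelBoundX (ρ : ℝ) (K : ℕ → ℕ → ℂ⟦X⟧) : Prop :=
  ∀ J, KernelBound ρ fun m a => nrm J (K m a)

/-- The rows over `ℂ⟦t⟧` whose seminorms are bounded by multiples of `phi`. -/
def RowBound (p : ℕ → ℂ⟦X⟧) : Prop := ∀ J, ∃ K, ∀ m, nrm J (p m) ≤ K * phi m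

/-- The product of a row with a kernel. -/
noncomputable def rowMul (p : ℕ → ℂ⟦X⟧) (K : ℕ → ℕ → ℂ⟦X⟧) (a : ℕ) : ℂ⟦X⟧ :=
  ∑ m ∈ range (a + 1), p m * K m a

/-- The first row of the unit kernel. -/
noncomputable def rowOne (m : ℕ) : ℂ⟦X⟧ := if m = 0 then 1 else 0

theorem KernelBound.mono {ρ ρ' : ℝ} (hρ : 0 ≤ ρ) (h : ρ ≤ ρ') {κ : ℕ → ℕ → ℝ}
    (hκ : KernelBound ρ κ) : KernelBound ρ' κ :=
  hκ.imp_right fun h' m a => (h' m a).trans (kup_mono hρ h m a)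

theorem RowBound.rowMul {p : ℕ → ℂ⟦X⟧} {K : ℕ → ℕ → ℂ⟦X⟧} (hp : RowBound p)
    (hK : KernelBoundX 1 K) : RowBound (rowMul p K) := by
  intro J
  obtain ⟨c, hc⟩ := hp J
  refine ⟨2 * c, fun a => ?_⟩
  refine (nrm_sum_le _ _ _).trans (le_trans (sum_le_sum fun m _ => nrm_mul_le _ _ _) ?_)
  exact row_mul_le (p := fun m => nrm J (p m)) (fun m => nrm_nonneg _ _) hc (hK J) a

theorem rowBound_rowOne : RowBound rowOne := by
  refine fun J => ⟨1, fun m => ?_⟩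
  by_cases hm : m = 0
  · subst hm; simp [rowOne, nrm_one, phi_zero]
  · simp [rowOne, hm, (phi_pos m).le]

theorem kernelBoundX_zero_zero {ρ : ℝ} {K : ℕ → ℕ → ℂ⟦X⟧} (hK : KernelBoundX ρ K) : K 0 0 = 0 := by
  ext j
  have h := norm_coeff_le j (K 0 0)
  rw [le_antisymm (kernelBound_zero_zero (hK j)) (nrm_nonneg _ _), mul_zero] at h
  simpa using h

theorem kernelBoundX_eq_zero {ρ : ℝ} {K : ℕ → ℕ → ℂ⟦X⟧} (hK : KernelBoundX ρ K) {m a : ℕ}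
    (h : ¬ m ≤ a) : K m a = 0 := by
  ext j
  have h' := norm_coeff_le j (K m a)
  rw [kernelBound_eq_zero (κ := fun m a => nrm j (K m a)) (fun _ _ => nrm_nonneg _ _) (hK j) h,
    mul_zero] at h'
  simpa using h'

theorem rowMul_zero {ρ : ℝ} (p : ℕ → ℂ⟦X⟧) {K : ℕ → ℕ → ℂ⟦X⟧} (hK : KernelBoundX ρ K) :
    rowMul p K 0 = 0 := by
  simp [rowMul, kernelBoundX_zero_zero hK]

variable {p q : ℕ → ℂ⟦X⟧} {K K' : ℕ → ℕ → ℂ⟦X⟧}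

/-- Only a, n ≥ 1 contribute; there C(a, n) ≤ 8/(an) splits the triple sum into a product of two
convergent sums. -/
theorem summable_triple (hp : RowBound p) (hq : RowBound q) (hq0 : q 0 = 0)
    (hK : KernelBoundX 1 K) :
    Summable fun x : (ℕ × ℕ) × ℕ => p x.1.1 * K x.1.1 x.1.2 * (q x.2 * connX x.1.2 x.2) := by
  refine summable_of_nrm fun J => ?_
  obtain ⟨c, hc⟩ := hp J
  obtain ⟨d, hd⟩ := hq J
  have h1 := summable_row_mul_div (fun m => nrm_nonneg J (p m)) hc
    (fun m a => nrm_nonneg J (K m a)) (hK J)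
  have h2 : Summable fun n => nrm J (q n) / (n : ℝ) := by
    refine Summable.of_nonneg_of_le (fun n => div_nonneg (nrm_nonneg _ _) (Nat.cast_nonneg _))
      (fun n => ?_) (summable_phi_div.mul_left d)
    rw [← mul_div_assoc]
    exact div_le_div_of_nonneg_right (hd n) (Nat.cast_nonneg _)
  have h3 := (h1.mul_of_nonneg h2
    (fun x => div_nonneg (mul_nonneg (nrm_nonneg _ _) (nrm_nonneg _ _)) (Nat.cast_nonneg _))
    (fun n => div_nonneg (nrm_nonneg _ _) (Nat.cast_nonneg _))).mul_left 8
  refine Summable.of_nonneg_of_le (fun x => nrm_nonneg _ _) ?_ h3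
  rintro ⟨⟨m, a⟩, n⟩
  rcases Nat.eq_zero_or_pos n with rfl | hn
  · simp [hq0]
  rcases Nat.eq_zero_or_pos a with rfl | ha
  · have : K m 0 = 0 := by
      rcases Nat.eq_zero_or_pos m with rfl | hm
      · exact kernelBoundX_zero_zero hK
      · exact kernelBoundX_eq_zero hK (by omega)
    simp [this]
  calc nrm J (p m * K m a * (q n * connX a n))
      ≤ (nrm J (p m) * nrm J (K m a)) * (nrm J (q n) * (8 / (a * n))) := by
        refine (nrm_mul_le _ _ _).trans (mul_le_mul (nrm_mul_le _ _ _)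
          ((nrm_mul_le _ _ _).trans (mul_le_mul_of_nonneg_left (nrm_connX_le J a n ha hn)
            (nrm_nonneg _ _))) (nrm_nonneg _ _) (mul_nonneg (nrm_nonneg _ _) (nrm_nonneg _ _)))
    _ = _ := by
        simp only
        field_simp

/-- Only n = 0 contributes and the connector is 1 there, so ρ < 1 replaces its decay. -/
theorem summable_triple_rowOne (hp : RowBound p) {ρ : ℝ} (hρ : 0 ≤ ρ) (hρ1 : ρ < 1)
    (hK : KernelBoundX ρ K) :
    Summable fun x : (ℕ × ℕ) × ℕ => p x.1.1 * K x.1.1 x.1.2 * (rowOne x.2 * connX x.1.2 x.2) := by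
  refine summable_of_nrm fun J => ?_
  obtain ⟨c, hc⟩ := hp J
  have h1 := summable_row_mul (fun m => nrm_nonneg J (p m)) hc
    (fun m a => nrm_nonneg J (K m a)) hρ hρ1 (hK J)
  have h2 : Summable fun n => if n = 0 then (1 : ℝ) else 0 :=
    summable_of_ne_finset_zero (s := {0}) fun n hn => if_neg (by simpa using hn)
  have h3 := h1.mul_of_nonneg h2 (fun x => mul_nonneg (nrm_nonneg _ _) (nrm_nonneg _ _))
    (fun n => by positivity)
  refine Summable.of_nonneg_of_le (fun x => nrm_nonneg _ _) ?_ h3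
  rintro ⟨⟨m, a⟩, n⟩
  by_cases hn : n = 0
  · subst hn
    simp only [rowOne, if_true, one_mul, mul_one]
    rw [connX, conn_zero_right sub_X_mul_recip, mul_one]
    exact nrm_mul_le _ _ _
  · simp [rowOne, hn]

/-- Fubini for triples ((m, a), n): summing over a first gives `V`, summing over the finitely many m
≤ a first gives `rowMul`. The two equivalences only reorder coordinates. -/
theorem hasSum_rowMul
    (hs : Summable fun x : (ℕ × ℕ) × ℕ => p x.1.1 * K x.1.1 x.1.2 * (q x.2 * connX x.1.2 x.2))
    (hK : ∀ m a, ¬ m ≤ a → K m a = 0) {V : ℕ × ℕ → ℂ⟦X⟧}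
    (hV : ∀ m n, HasSum (fun a => p m * q n * (K m a * connX a n)) (V (m, n))) :
    ∑' x : ℕ × ℕ, rowMul p K x.1 * q x.2 * connX x.1 x.2 = ∑' x, V x := by
  obtain ⟨s, hs⟩ := hs
  have h1 : HasSum V s := by
    let e : (ℕ × ℕ) × ℕ ≃ (ℕ × ℕ) × ℕ :=
      ⟨fun x => ((x.1.1, x.2), x.1.2), fun x => ((x.1.1, x.2), x.1.2), fun _ => rfl, fun _ => rfl⟩
    refine ((e.hasSum_iff).2 hs).prod_fiberwise fun x => ?_
    refine (hV x.1 x.2).congr_fun fun a => ?_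
    simp only [e, Function.comp_apply, Equiv.coe_fn_mk]
    ring
  have h2 : HasSum (fun x : ℕ × ℕ => rowMul p K x.1 * q x.2 * connX x.1 x.2) s := by
    let e : (ℕ × ℕ) × ℕ ≃ (ℕ × ℕ) × ℕ :=
      ⟨fun x => ((x.2, x.1.1), x.1.2), fun x => ((x.1.2, x.2), x.1.1), fun _ => rfl, fun _ => rfl⟩
    refine ((e.hasSum_iff).2 hs).prod_fiberwise fun x => ?_
    have h3 : ∀ m ∉ range (x.1 + 1), p m * K m x.1 * (q x.2 * connX x.1 x.2) = 0 := fun m hm => by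
      rw [hK m x.1 (by simpa using hm)]; simp
    rw [mul_assoc, rowMul, sum_mul]
    exact hasSum_sum_of_ne_finset_zero h3
  rw [h1.tsum_eq, h2.tsum_eq]

/-- The connected sum of two rows. -/
noncomputable def connSum (p q : ℕ → ℂ⟦X⟧) : ℂ⟦X⟧ := ∑' x : ℕ × ℕ, p x.1 * q x.2 * connX x.1 x.2

theorem connSum_comm (p q : ℕ → ℂ⟦X⟧) : connSum p q = connSum q p := by
  rw [connSum, ← (Equiv.prodComm ℕ ℕ).tsum_eq]
  refine tsum_congr fun x => ?_
  simp only [Equiv.prodComm_apply, Prod.fst_swap, Prod.snd_swap, connX]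
  rw [conn_comm, mul_comm (p _)]

theorem connSum_rowMul
    (hs : Summable fun x : (ℕ × ℕ) × ℕ => p x.1.1 * K x.1.1 x.1.2 * (q x.2 * connX x.1.2 x.2))
    (hs' : Summable fun x : (ℕ × ℕ) × ℕ => q x.1.1 * K' x.1.1 x.1.2 * (p x.2 * connX x.1.2 x.2))
    (hK : ∀ m a, ¬ m ≤ a → K m a = 0) (hK' : ∀ m a, ¬ m ≤ a → K' m a = 0)
    (h : ∀ m n, p m = 0 ∨ q n = 0 ∨ Transports K K' m n) :
    connSum (rowMul p K) q = connSum p (rowMul q K') := by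
  have h' : ∀ x : ℕ × ℕ, ∃ T, HasSum (fun a => p x.1 * q x.2 * (K x.1 a * connX a x.2)) T ∧
      HasSum (fun b => p x.1 * q x.2 * (K' x.2 b * connX x.1 b)) T := by
    rintro ⟨m, n⟩
    rcases h m n with h | h | ⟨T, h1, h2⟩
    · exact ⟨0, by simp [h, hasSum_zero], by simp [h, hasSum_zero]⟩
    · exact ⟨0, by simp [h, hasSum_zero], by simp [h, hasSum_zero]⟩
    · exact ⟨_, h1.mul_left _, h2.mul_left _⟩
  choose V hV hV' using h'
  rw [connSum_comm p, connSum, hasSum_rowMul hs hK fun m n => hV (m, n), connSum,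
    hasSum_rowMul (V := fun x => V x.swap) hs' hK' fun m n => ?_]
  · exact ((Equiv.prodComm ℕ ℕ).tsum_eq V).symm
  · refine (hV' (n, m)).congr_fun fun b => ?_
    simp only [connX]
    rw [conn_comm]
    ring

theorem connSum_rowOne_right (p : ℕ → ℂ⟦X⟧) : connSum p rowOne = ∑' a, p a := by
  rw [connSum, ← Function.Injective.tsum_eq (g := fun a : ℕ => (a, 0))
    (fun a b h => (Prod.ext_iff.1 h).1)]
  · refine tsum_congr fun a => ?_
    simp [rowOne, connX, conn_zero_right sub_X_mul_recip]
  · rintro ⟨a, n⟩ h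
    have hn : n = 0 := by
      by_contra hn
      exact h (by simp [rowOne, hn])
    exact ⟨a, by rw [hn]⟩

end Rows

/-! ### Bounds for the kernels -/

section KernelBounds

open PowerSeries (C)

theorem kernelBoundX_kerX (ρ : ℝ) : KernelBoundX ρ kerX := by
  refine fun J => Or.inl fun m a => ?_
  simp only [kerX, kd]
  split_ifs
  · rw [nrm_C]; simp
  · simp

theorem kernelBoundX_kerE (z : ℂ) : KernelBoundX ‖z‖ (kerE z) := by
  refine fun J => Or.inr fun m a => ?_
  by_cases h : m < a
  · refine le_trans ?_ (rr_le_kup (norm_nonneg z) h)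
    simp only [kerE]
    rw [if_pos h, ← map_pow]
    refine (nrm_mul_le _ _ _).trans ?_
    rw [nrm_C, norm_pow]
    obtain ⟨a, rfl⟩ : ∃ b, a = b + 1 := ⟨a - 1, by omega⟩
    gcongr
    exact nrm_recip_le_rr J a
  · simp [kerE, if_neg h, kup_nonneg]

/-- At t = 1/4 the product in `kerT` is hh (a - 1) / hh m, which explains the factor `hh a / (a * hh
m)` in `kup`. -/
theorem kernelBoundX_kerT (z : ℂ) : KernelBoundX ‖z‖ (kerT z) := by
  refine fun J => Or.inr fun m a => ?_
  by_cases h : m < a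
  · obtain ⟨k, rfl⟩ : ∃ k, a = m + k + 1 := ⟨a - m - 1, by omega⟩
    simp only [kerT, kup]
    rw [if_pos h, if_pos h, ← map_pow, nrm_neg, mul_assoc, show m + k + 1 - m = k + 1 by omega,
      Nat.add_sub_cancel]
    have h1 : hh (m + k + 1) / (((m + k + 1 : ℕ) : ℝ) * hh m) = rr (m + k + 1) *
        ∏ i ∈ range k, (((m + i + 1 : ℕ) : ℝ) * rr (m + i + 1)) := by
      have h2 : hh (m + k) = hh m * ∏ i ∈ range k, (((m + i + 1 : ℕ) : ℝ) * rr (m + i + 1)) :=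
        prod_range_add _ _ _
      have h3 := (hh_pos m).ne'
      rw [hh_succ, h2]
      field_simp
    rw [h1]
    refine (nrm_mul_le _ _ _).trans ?_
    rw [nrm_C, norm_pow]
    refine mul_le_mul_of_nonneg_left ?_ (by positivity)
    refine (nrm_mul_le _ _ _).trans (mul_le_mul (nrm_recip_le_rr _ _) ?_ (nrm_nonneg _ _)
      (rr_succ_pos _).le)
    refine nrm_prod_le _ _ _ _ fun i _ => (nrm_mul_le _ _ _).trans ?_
    rw [nrm_natCast]
    gcongr
    exact nrm_recip_le_rr _ _
  · simp [kerT, if_neg h, kup_nonneg]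

end KernelBounds

/-! ### The representation of the algebra by triangular kernels -/

section Representation

open PowerSeries (C)
open MulOpposite (unop)

/-- The kernels of the letters. -/
noncomputable def rhoGen : Letter → IncidenceAlgebra ℂ ℕ
  | Letter.x => ⟨fun m a => if m = a then 1 / (a : ℂ) else 0, fun _ _ h => if_neg fun h' => h h'.le⟩
  | Letter.e z => ⟨fun m a => if m < a then (z : ℂ) ^ (a - m) / (a : ℂ) else 0,
      fun _ _ h => if_neg fun h' => h h'.le⟩

/-- The representation of `𝒜` by triangular kernels. -/
noncomputable def rho : Alg →ₐ[ℚ] IncidenceAlgebra ℂ ℕ := FreeAlgebra.lift ℚ rhoGen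

/-- The entry `(m, a)` of a kernel as a linear map. -/
def entry (m a : ℕ) : IncidenceAlgebra ℂ ℕ →ₗ[ℚ] ℂ where
  toFun f := f m a
  map_add' _ _ := rfl
  map_smul' _ _ := rfl

theorem entry_apply (m a : ℕ) (f : IncidenceAlgebra ℂ ℕ) : entry m a f = f m a := rfl

/-- The kernel over `ℂ⟦t⟧` of an element of `𝒜⟦t⟧`. -/
noncomputable def ker (f : Alg⟦X⟧) (m a : ℕ) : ℂ⟦X⟧ :=
  PowerSeries.mk fun j => rho (PowerSeries.coeff j f) m a

theorem coeff_ker (f : Alg⟦X⟧) (m a j : ℕ) :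
    PowerSeries.coeff j (ker f m a) = rho (PowerSeries.coeff j f) m a :=
  PowerSeries.coeff_mk _ _

theorem ker_add (f g : Alg⟦X⟧) (m a : ℕ) : ker (f + g) m a = ker f m a + ker g m a := by
  ext j; simp [coeff_ker]

theorem ker_neg (f : Alg⟦X⟧) (m a : ℕ) : ker (-f) m a = -ker f m a := by
  ext j; simp [coeff_ker]

theorem ker_mul (f g : Alg⟦X⟧) (m a : ℕ) :
    ker (f * g) m a = ∑ b ∈ Icc m a, ker f m b * ker g b a := by
  ext j
  simp only [coeff_ker, PowerSeries.coeff_mul, map_sum, ← entry_apply m a]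
  rw [sum_comm]
  refine sum_congr rfl fun p _ => ?_
  simp only [entry_apply, map_mul, IncidenceAlgebra.mul_apply]

theorem ker_mul_X (f : Alg⟦X⟧) (m a : ℕ) :
    ker (f * PowerSeries.X) m a = ker f m a * PowerSeries.X := by
  ext j
  cases j with
  | zero => simp [coeff_ker]
  | succ j => simp [coeff_ker, PowerSeries.coeff_succ_mul_X]

theorem ker_one (m a : ℕ) : ker 1 m a = if m = a then 1 else 0 := by
  ext j
  rw [coeff_ker, PowerSeries.coeff_one]
  by_cases hj : j = 0
  · by_cases h : m = a <;> simp [hj, h]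
  · by_cases h : m = a <;> simp [hj, h, PowerSeries.coeff_one]

theorem ker_C (v : Alg) (m a : ℕ) : ker (C v) m a = C (rho v m a) := by
  ext j
  rw [coeff_ker, PowerSeries.coeff_C, PowerSeries.coeff_C]
  split_ifs <;> simp

theorem rho_gx (m a : ℕ) : rho gx m a = if m = a then 1 / (a : ℂ) else 0 := by
  rw [rho, gx, FreeAlgebra.lift_ι_apply]; rfl

theorem rho_ge (z : BSet) (m a : ℕ) :
    rho (ge z) m a = if m < a then (z : ℂ) ^ (a - m) / (a : ℂ) else 0 := by
  rw [rho, ge, FreeAlgebra.lift_ι_apply]; rfl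

theorem rho_mul_gx (v : Alg) (m a : ℕ) : rho (v * gx) m a = rho v m a / a := by
  rw [map_mul, IncidenceAlgebra.mul_apply]
  by_cases h : m ≤ a
  · rw [sum_eq_single a]
    · rw [rho_gx, if_pos rfl, mul_one_div]
    · intro b _ hb
      rw [rho_gx, if_neg hb, mul_zero]
    · intro ha; simp [h] at ha
  · rw [IncidenceAlgebra.apply_eq_zero_of_not_le h, zero_div, Icc_eq_empty h, sum_empty]

theorem rho_mul_gx_pow (v : Alg) (m a j : ℕ) : rho (v * gx ^ j) m a = rho v m a / (a : ℂ) ^ j := by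
  induction j with
  | zero => simp
  | succ j ih => rw [pow_succ, ← mul_assoc, rho_mul_gx, ih, pow_succ, div_div]

theorem ker_C_gx : ker (C gx) = kerX := by
  funext m a
  rw [ker_C, rho_gx, kerX]
  split_ifs <;> simp

theorem ker_ge_geom (z : BSet) : ker (C (ge z) * geom gx) = kerE z := by
  funext m a
  ext j
  rw [coeff_ker, PowerSeries.coeff_C_mul, geom, PowerSeries.coeff_mk, rho_mul_gx_pow, rho_ge, kerE]
  split_ifs with h
  · rw [← map_pow, PowerSeries.coeff_C_mul, recip, PowerSeries.coeff_mk, div_div, mul_one_div,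
      pow_succ']
  · simp

/-- This is σ applied to e(1 - et)⁻¹ = e + e(1 - et)⁻¹ e t. It determines the kernel column by
column and also displays the last letters. -/
theorem sigma_ge_geom (z : BSet) :
    sigma (C (ge z) * geom (ge z)) = C (ge z) * geom gx +
      sigma (C (ge z) * geom (ge z)) * (C (ge z) * geom gx) * PowerSeries.X := by
  have h : C (ge z) * geom (ge z) =
      C (ge z) + C (ge z) * geom (ge z) * C (ge z) * PowerSeries.X := by
    have := geom_mul (ge z)
    rw [mul_sub, mul_one, sub_eq_iff_eq_add] at this
    conv_lhs => rw [this]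
    noncomm_ring
  conv_lhs => rw [h]
  rw [map_add, map_mul, map_mul, sigma_e, sigma_t]

/-- Telescoping, from j/(j - t) = 1 + t/(j - t). -/
theorem kerT_prod_sum (m k : ℕ) :
    ∏ i ∈ range k, (((m + i + 1 : ℕ) : ℂ⟦X⟧) * recip (m + i + 1)) =
      1 + (∑ j ∈ range k, recip (m + j + 1) *
        ∏ i ∈ range j, (((m + i + 1 : ℕ) : ℂ⟦X⟧) * recip (m + i + 1))) * PowerSeries.X := by
  induction k with
  | zero => simp
  | succ k ih =>
    rw [prod_range_succ, sum_range_succ, add_mul, ← add_assoc, ← ih]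
    linear_combination (∏ i ∈ range k, (((m + i + 1 : ℕ) : ℂ⟦X⟧) * recip (m + i + 1))) *
      sub_X_mul_recip (m + k)

/-- As `kerE` is strictly triangular, the recursion gives column a from the columns b < a. The
powers of z combine to z^(a-m), and `kerT_prod_sum` sums the rest. -/
theorem ker_sigma_ge_geom (z : BSet) : ker (sigma (-(C (ge z) * geom (ge z)))) = kerT z := by
  funext m a
  rw [map_neg, ker_neg]
  have hrec : ∀ a, ker (sigma (C (ge z) * geom (ge z))) m a = kerE z m a +
      (∑ b ∈ Icc m a, ker (sigma (C (ge z) * geom (ge z))) m b * kerE z b a) * PowerSeries.X := by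
    intro a
    conv_lhs => rw [sigma_ge_geom]
    rw [ker_add, ker_mul_X, ker_mul (sigma _), ker_ge_geom]
  induction a using Nat.strong_induction_on with
  | _ a ih =>
    rw [hrec]
    by_cases h : m < a
    · obtain ⟨k, rfl⟩ : ∃ k, a = m + k + 1 := ⟨a - m - 1, by omega⟩
      have h1 : ∑ b ∈ Icc m (m + k + 1),
          ker (sigma (C (ge z) * geom (ge z))) m b * kerE z b (m + k + 1) =
          C (z : ℂ) ^ (k + 1) * recip (m + k + 1) * ∑ j ∈ range k, recip (m + j + 1) *
            ∏ i ∈ range j, (((m + i + 1 : ℕ) : ℂ⟦X⟧) * recip (m + i + 1)) := by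
        have h2 : ∀ b ∈ Icc m (m + k + 1),
            ker (sigma (C (ge z) * geom (ge z))) m b * kerE z b (m + k + 1) =
              -kerT z m b * kerE z b (m + k + 1) := by
          intro b hb
          by_cases hb' : b < m + k + 1
          · rw [← ih b hb', neg_neg]
          · rw [kerE, if_neg hb', mul_zero, mul_zero]
        rw [sum_congr rfl h2, ← Ico_succ_right_eq_Icc, sum_Ico_eq_sum_range, Order.succ_eq_add_one,
          show m + k + 1 + 1 - m = k + 1 + 1 by omega, sum_range_succ, sum_range_succ']
        rw [kerT, if_neg (by omega), neg_zero, zero_mul, add_zero, kerE, if_neg (by omega), mul_zero,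
          add_zero, mul_sum]
        refine sum_congr rfl fun j hj => ?_
        have hj := mem_range.1 hj
        rw [kerT, if_pos (by omega), kerE, if_pos (by omega), show m + (j + 1) - m = j + 1 by omega,
          show m + k + 1 - (m + (j + 1)) = k - j by omega, Nat.add_sub_cancel, neg_neg,
          show k + 1 = (j + 1) + (k - j) by omega, pow_add, ← add_assoc m j 1]
        ring
      rw [h1, kerE, if_pos h, kerT, if_pos h, show m + k + 1 - m = k + 1 by omega,
        Nat.add_sub_cancel, kerT_prod_sum]
      ring
    · rw [kerE, kerT, if_neg h, if_neg h, zero_add, sum_eq_zero, zero_mul, neg_zero]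
      intro b hb
      have := mem_Icc.1 hb
      rw [kerE, if_neg (by omega), mul_zero]

theorem ker_mul_zero (f g : Alg⟦X⟧) : ker (f * g) 0 = rowMul (ker f 0) (ker g) := by
  funext a
  rw [ker_mul, rowMul, Nat.range_succ_eq_Icc_zero]

theorem ker_one_zero : ker 1 0 = rowOne := by
  funext a
  rw [ker_one, rowOne]
  simp only [eq_comm]

/-- The kernel of `σ` of a letter. -/
noncomputable def kerS (l : Letter) : ℕ → ℕ → ℂ⟦X⟧ := ker (sigma (C (FreeAlgebra.ι ℚ l)))

/-- The kernel of `σ τ` of a letter. -/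
noncomputable def kerST (l : Letter) : ℕ → ℕ → ℂ⟦X⟧ :=
  ker (sigma (unop (tau (C (FreeAlgebra.ι ℚ l)))))

theorem kerS_x : kerS Letter.x = kerX := by
  rw [kerS, ← ker_C_gx, ← sigma_x]; rfl

theorem kerS_e (z : BSet) : kerS (Letter.e z) = kerE z := by
  rw [kerS, ← ker_ge_geom, ← sigma_e]; rfl

theorem kerST_x : kerST Letter.x = kerE 1 := by
  have h : unop (tau (C (FreeAlgebra.ι ℚ Letter.x))) = C (ge oneB) := tau_x
  rw [kerST, h, sigma_e, ker_ge_geom]; rfl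

theorem kerST_e_one : kerST (Letter.e oneB) = kerX := by
  have h : unop (tau (C (FreeAlgebra.ι ℚ (Letter.e oneB)))) = C gx := tau_e_one
  rw [kerST, h, sigma_x, ker_C_gx]

theorem kerST_e (z : BSet) (hz : z ≠ oneB) : kerST (Letter.e z) = kerT (z / (z - 1) : ℂ) := by
  have h : unop (tau (C (FreeAlgebra.ι ℚ (Letter.e z)))) =
    -(C (ge (dualB z hz)) * geom (ge (dualB z hz))) := tau_e z hz
  rw [kerST, h, ker_sigma_ge_geom]; rfl

/-- The letters `e_z` with `Re z ≠ 1/2`. -/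
def StartOK : Letter → Prop
  | Letter.x => False
  | Letter.e z => (z : ℂ).re ≠ 1 / 2

/-- The letter `x` and the letters `e_z` with `|z| ≠ 1`. -/
def EndOK : Letter → Prop
  | Letter.x => True
  | Letter.e z => ‖(z : ℂ)‖ ≠ 1

theorem norm_le_one (z : BSet) : ‖(z : ℂ)‖ ≤ 1 := z.2.1.1

theorem norm_dualB_lt_one {z : BSet} (hz : z ≠ oneB) (h : (z : ℂ).re ≠ 1 / 2) :
    ‖(z / (z - 1) : ℂ)‖ < 1 := by
  have h1 : (z : ℂ) - 1 ≠ 0 := sub_ne_zero.2 fun h4 => hz (Subtype.ext h4)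
  obtain ⟨_, _, h2 | h2⟩ := (mem_BSet_iff z).1 z.2
  · exact absurd (Subtype.ext h2) hz
  · rw [norm_div, div_lt_one (norm_pos_iff.2 h1)]
    refine lt_of_le_of_ne ((norm_le_norm_sub_one_iff _).2 h2) fun h3 => h (le_antisymm h2 ?_)
    -- The criterion `norm_le_norm_sub_one_iff` is one-sided; at 1 - z it yields Re z ≥ 1/2.
    have h4 : ‖(1 - z : ℂ)‖ ≤ ‖(1 - z : ℂ) - 1‖ := by
      rw [norm_sub_rev, ← h3, show (1 - z : ℂ) - 1 = -z by ring, norm_neg]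
    rw [norm_le_norm_sub_one_iff] at h4
    simp only [Complex.sub_re, Complex.one_re] at h4
    linarith

theorem exists_kernelBoundX_kerS (l : Letter) :
    ∃ ρ, 0 ≤ ρ ∧ ρ ≤ 1 ∧ (EndOK l → ρ < 1) ∧ KernelBoundX ρ (kerS l) := by
  obtain _ | z := l
  -- The choice ρ = 0 is free: the diagonal alternative of `KernelBound` does not involve ρ.
  · exact ⟨0, le_rfl, zero_le_one, fun _ => zero_lt_one, kerS_x ▸ kernelBoundX_kerX 0⟩
  · exact ⟨‖(z : ℂ)‖, norm_nonneg _, norm_le_one z, fun h => lt_of_le_of_ne (norm_le_one z) h,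
      kerS_e z ▸ kernelBoundX_kerE z⟩

theorem exists_kernelBoundX_kerST (l : Letter) :
    ∃ ρ, 0 ≤ ρ ∧ ρ ≤ 1 ∧ (StartOK l → ρ < 1) ∧ KernelBoundX ρ (kerST l) := by
  obtain _ | z := l
  · refine ⟨1, zero_le_one, le_rfl, False.elim, ?_⟩
    rw [kerST_x]
    simpa using kernelBoundX_kerE 1
  · by_cases hz : z = oneB
    · subst hz
      exact ⟨0, le_rfl, zero_le_one, fun _ => zero_lt_one, kerST_e_one ▸ kernelBoundX_kerX 0⟩
    · exact ⟨‖(z / (z - 1) : ℂ)‖, norm_nonneg _, norm_le_one (dualB z hz),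
        fun h => norm_dualB_lt_one hz h, kerST_e z hz ▸ kernelBoundX_kerT _⟩

theorem KernelBoundX.mono {ρ ρ' : ℝ} (hρ : 0 ≤ ρ) (h : ρ ≤ ρ') {K : ℕ → ℕ → ℂ⟦X⟧}
    (hK : KernelBoundX ρ K) : KernelBoundX ρ' K := fun J => (hK J).mono hρ h

theorem kernelBoundX_kerS (l : Letter) : KernelBoundX 1 (kerS l) := by
  obtain ⟨ρ, h0, h1, -, h⟩ := exists_kernelBoundX_kerS l
  exact h.mono h0 h1

theorem kernelBoundX_kerST (l : Letter) : KernelBoundX 1 (kerST l) := by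
  obtain ⟨ρ, h0, h1, -, h⟩ := exists_kernelBoundX_kerST l
  exact h.mono h0 h1

/-- The letters `x` and e_1 are exchanged by τ, so their cases mirror each other. For z ≠ 1 the two
letter conditions give |z/(z-1)| < 1 and |z| < 1, which ensure convergence at m = 0 and at n = 0. -/
theorem transports_kerS_kerST (l : Letter) {m n : ℕ} (hm : 1 ≤ m ∨ StartOK l)
    (hn : 1 ≤ n ∨ EndOK l) : Transports (kerS l) (kerST l) m n := by
  obtain _ | z := l
  · rw [kerS_x, kerST_x]
    exact (transports_kerE_one n (hm.resolve_right id)).symm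
  · rw [kerS_e]
    by_cases hz : z = oneB
    · subst hz
      rw [kerST_e_one]
      exact transports_kerE_one m (hn.resolve_right fun h => h (by simp [oneB]))
    · rw [kerST_e z hz]
      have h1 : (z : ℂ) - 1 ≠ 0 := sub_ne_zero.2 fun h4 => hz (Subtype.ext h4)
      exact transports_kerE_kerT (div_mul_cancel₀ _ h1) (norm_le_one z) (norm_le_one (dualB z hz))
        (hm.symm.imp_left fun h => norm_dualB_lt_one hz h)
        (hn.symm.imp_left fun h => lt_of_le_of_ne (norm_le_one z) h)

/-- The first row of the kernel of `σ` of a word. -/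
noncomputable def rowS (w : List Letter) : ℕ → ℂ⟦X⟧ := ker (sigma (C (ofWord w))) 0

/-- The first row of the kernel of `σ τ` of a word. -/
noncomputable def rowST (w : List Letter) : ℕ → ℂ⟦X⟧ := ker (sigma (unop (tau (C (ofWord w))))) 0

/-! ### Moving letters across the connected sum -/

theorem rowS_nil : rowS [] = rowOne := by
  simp [rowS, ofWord, ker_one_zero]

theorem rowST_nil : rowST [] = rowOne := by
  simp [rowST, ofWord, ker_one_zero]

theorem rowS_append (w : List Letter) (l : Letter) :
    rowS (w ++ [l]) = rowMul (rowS w) (kerS l) := by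
  rw [rowS, rowS, kerS, ← ker_mul_zero, ← map_mul, ← map_mul]
  simp [ofWord]

/-- Because τ reverses products, a letter put in front of the word multiplies the row from the
right. -/
theorem rowST_cons (w : List Letter) (l : Letter) :
    rowST (l :: w) = rowMul (rowST w) (kerST l) := by
  rw [rowST, rowST, kerST, ← ker_mul_zero, ← map_mul, ← MulOpposite.unop_mul, ← map_mul, ← map_mul]
  simp [ofWord]

theorem rowBound_rowS (w : List Letter) : RowBound (rowS w) := by
  induction w using List.reverseRecOn with
  | nil => rw [rowS_nil]; exact rowBound_rowOne
  | append_singleton w l ih => rw [rowS_append]; exact ih.rowMul (kernelBoundX_kerS l)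

theorem rowBound_rowST (w : List Letter) : RowBound (rowST w) := by
  induction w with
  | nil => rw [rowST_nil]; exact rowBound_rowOne
  | cons l w ih => rw [rowST_cons]; exact ih.rowMul (kernelBoundX_kerST l)

theorem rowS_zero {w : List Letter} (hw : w ≠ []) : rowS w 0 = 0 := by
  rw [← List.dropLast_append_getLast hw, rowS_append]
  exact rowMul_zero _ (kernelBoundX_kerS _)

theorem rowST_zero {w : List Letter} (hw : w ≠ []) : rowST w 0 = 0 := by
  obtain ⟨l, u, rfl⟩ := List.exists_cons_of_ne_nil hw
  rw [rowST_cons]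
  exact rowMul_zero _ (kernelBoundX_kerST l)

/-- A nonempty side has a row that vanishes at 0, so transport at 0 is not needed for it. An empty
side has its row supported at 0, and then l satisfies the matching boundary condition. -/
theorem connSum_transport (u v : List Letter) (l : Letter) (hu : u ≠ [] ∨ StartOK l)
    (hv : v ≠ [] ∨ EndOK l) :
    connSum (rowS (u ++ [l])) (rowST v) = connSum (rowS u) (rowST (l :: v)) := by
  rw [rowS_append, rowST_cons]
  refine connSum_rowMul ?_ ?_ (fun m a => kernelBoundX_eq_zero (kernelBoundX_kerS l))
    (fun m a => kernelBoundX_eq_zero (kernelBoundX_kerST l)) fun m n => ?_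
  · by_cases hv0 : v = []
    · subst hv0
      obtain ⟨ρ, h0, -, h1, h⟩ := exists_kernelBoundX_kerS l
      rw [rowST_nil]
      exact summable_triple_rowOne (rowBound_rowS u) h0 (h1 (hv.resolve_left fun h => h rfl)) h
    · exact summable_triple (rowBound_rowS u) (rowBound_rowST v) (rowST_zero hv0)
        (kernelBoundX_kerS l)
  · by_cases hu0 : u = []
    · subst hu0
      obtain ⟨ρ, h0, -, h1, h⟩ := exists_kernelBoundX_kerST l
      rw [rowS_nil]
      exact summable_triple_rowOne (rowBound_rowST v) h0 (h1 (hu.resolve_left fun h => h rfl)) h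
    · exact summable_triple (rowBound_rowST v) (rowBound_rowS u) (rowS_zero hu0)
        (kernelBoundX_kerST l)
  · by_cases hm : 1 ≤ m ∨ StartOK l
    · by_cases hn : 1 ≤ n ∨ EndOK l
      · exact Or.inr (Or.inr (transports_kerS_kerST l hm hn))
      · obtain ⟨hn, hl⟩ := not_or.1 hn
        obtain rfl : n = 0 := by omega
        exact Or.inr (Or.inl (rowST_zero (hv.resolve_right hl)))
    · obtain ⟨hm, hl⟩ := not_or.1 hm
      obtain rfl : m = 0 := by omega
      exact Or.inl (rowS_zero (hu.resolve_right hl))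

/-- The words that span `𝒜⁰`. -/
def Admissible (w : List Letter) : Prop :=
  (∀ l, w.head? = some l → StartOK l) ∧ ∀ l, w.getLast? = some l → EndOK l

theorem connSum_rowS_eq {w : List Letter} (hw : Admissible w) (u v : List Letter)
    (h : u ++ v = w) : connSum (rowS u) (rowST v) = connSum rowOne (rowST w) := by
  induction u using List.reverseRecOn generalizing v with
  | nil => rw [rowS_nil, ← h, List.nil_append]
  | append_singleton u l ih =>
    rw [← ih (l :: v) (by simpa using h)]
    refine connSum_transport u v l ?_ ?_
    · by_cases hu : u = []
      · exact Or.inr (hw.1 l (by simp [← h, hu]))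
      · exact Or.inl hu
    · by_cases hv : v = []
      · exact Or.inr (hw.2 l (by simp [← h, hv]))
      · exact Or.inl hv

theorem tsum_rowS_eq_tsum_rowST {w : List Letter} (hw : Admissible w) :
    ∑' a, rowS w a = ∑' a, rowST w a := by
  have h := connSum_rowS_eq hw w [] (List.append_nil w)
  rwa [rowST_nil, connSum_comm rowOne, connSum_rowOne_right, connSum_rowOne_right] at h

end Representation

/-! ### Sums over chains -/

section Chains

variable {𝕜 : Type*} [NormedField 𝕜]

/-- The last entry of a chain. -/
def Chain.last {r : ℕ} (c : Chain r) : ℕ := c.1 (Fin.last r)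

/-- The chain with one more entry. -/
def Chain.snoc {r : ℕ} (c : Chain r) (a : ℕ) (h : c.last < a) : Chain (r + 1) :=
  ⟨Fin.snoc (α := fun _ => ℕ) c.1 a, by
    exact (Fin.snoc_castSucc (α := fun _ => ℕ) a c.1 0).trans c.2.1, by
    rw [Fin.strictMono_iff_lt_succ]
    intro i
    rw [Fin.snoc_castSucc]
    refine Fin.lastCases ?_ (fun j => ?_) i
    · rw [Fin.succ_last, Fin.snoc_last]; exact h
    · rw [Fin.succ_castSucc, Fin.snoc_castSucc]
      exact c.2.2 j.castSucc_lt_succ⟩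

theorem Chain.snoc_castSucc {r : ℕ} (c : Chain r) (a : ℕ) (h : c.last < a) (i : Fin (r + 1)) :
    (c.snoc a h).1 i.castSucc = c.1 i := Fin.snoc_castSucc (α := fun _ => ℕ) _ _ _

theorem Chain.snoc_last {r : ℕ} (c : Chain r) (a : ℕ) (h : c.last < a) :
    (c.snoc a h).last = a := Fin.snoc_last (α := fun _ => ℕ) _ _

theorem Chain.exists_snoc {r : ℕ} (c : Chain (r + 1)) :
    ∃ (d : Chain r) (h : d.last < c.last), d.snoc c.last h = c := by
  refine ⟨⟨fun i => c.1 i.castSucc, c.2.1, fun i j h => c.2.2 (by simpa using h)⟩,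
    c.2.2 (Fin.castSucc_lt_last _), Subtype.ext (funext fun i => ?_)⟩
  refine Fin.lastCases ?_ (fun j => ?_) i
  · exact Chain.snoc_last _ _ _
  · exact Chain.snoc_castSucc _ _ _ _

/-- The summand of a multiple polylogarithm over a normed field. -/
def chainTerm {r : ℕ} (k : Fin r → ℕ+) (z : Fin r → 𝕜) (c : Chain r) : 𝕜 :=
  ∏ i : Fin r, z i ^ (c.1 i.succ - c.1 i.castSucc) / (c.1 i.succ : 𝕜) ^ (k i : ℕ)

/-- The sum of `chainTerm` over the chains with a given last entry. -/
def chainRow : (r : ℕ) → (Fin r → ℕ+) → (Fin r → 𝕜) → ℕ → 𝕜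
  | 0, _, _, a => if a = 0 then 1 else 0
  | r + 1, k, z, a => ∑ m ∈ range a,
      chainRow r (fun i => k i.castSucc) (fun i => z i.castSucc) m *
        (z (Fin.last r) ^ (a - m) / (a : 𝕜) ^ (k (Fin.last r) : ℕ))

theorem chainTerm_snoc {r : ℕ} (k : Fin (r + 1) → ℕ+) (z : Fin (r + 1) → 𝕜) (c : Chain r) (a : ℕ)
    (h : c.last < a) : chainTerm k z (c.snoc a h) =
      chainTerm (fun i => k i.castSucc) (fun i => z i.castSucc) c *
        (z (Fin.last r) ^ (a - c.last) / (a : 𝕜) ^ (k (Fin.last r) : ℕ)) := by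
  rw [chainTerm, Fin.prod_univ_castSucc, chainTerm]
  have h1 : (c.snoc a h).1 (Fin.last r).succ = a := by
    rw [Fin.succ_last]; exact c.snoc_last a h
  rw [h1, Chain.snoc_castSucc]
  congr 1
  refine prod_congr rfl fun i _ => ?_
  rw [Fin.succ_castSucc, Chain.snoc_castSucc, Chain.snoc_castSucc]

theorem hasSum_chainRow {r : ℕ} (k : Fin r → ℕ+) (z : Fin r → 𝕜) (a : ℕ) :
    HasSum (fun c : Chain r => if c.last = a then chainTerm k z c else 0) (chainRow r k z a) := by
  induction r generalizing a with
  | zero =>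
    have : Unique (Chain 0) :=
      ⟨⟨⟨fun _ => 0, rfl, fun i j h => by omega⟩⟩, fun c => Subtype.ext (funext fun i => by
        rw [Fin.fin_one_eq_zero i]; exact c.2.1)⟩
    have h0 : (default : Chain 0).last = 0 := (default : Chain 0).2.1
    have h := hasSum_unique fun c : Chain 0 => if c.last = a then chainTerm k z c else 0
    rw [h0] at h
    simpa [chainRow, chainTerm, eq_comm] using h
  | succ r ih =>
    let k' : Fin r → ℕ+ := fun i => k i.castSucc
    let z' : Fin r → 𝕜 := fun i => z i.castSucc
    -- The chains ending in a are exactly the shorter chains with last entry below a, extended by a.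
    let e : {c : Chain r | c.last < a} → Chain (r + 1) := fun c => c.1.snoc a c.2
    have he : Function.Injective e := by
      intro c d h
      refine Subtype.ext (Subtype.ext (funext fun i => ?_))
      have := congrArg (fun c : Chain (r + 1) => c.1 i.castSucc) h
      simpa only [e, Chain.snoc_castSucc] using this
    rw [← he.hasSum_iff]
    · have h1 : HasSum (fun c : Chain r => ∑ m ∈ range a, (if c.last = m then chainTerm k' z' c else 0) *
          (z (Fin.last r) ^ (a - m) / (a : 𝕜) ^ (k (Fin.last r) : ℕ))) (chainRow (r + 1) k z a) :=
        hasSum_sum fun m _ => (ih k' z' m).mul_right _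
      have h2 : (fun c => if c.last = a then chainTerm k z c else 0) ∘ e =
          (fun c : Chain r => chainTerm k' z' c *
            (z (Fin.last r) ^ (a - c.last) / (a : 𝕜) ^ (k (Fin.last r) : ℕ))) ∘ (↑) := by
        funext c
        simp only [Function.comp_apply, e, Chain.snoc_last, if_true, chainTerm_snoc]
        rfl
      rw [h2, hasSum_subtype_iff_indicator]
      refine h1.congr_fun fun c => ?_
      simp only [ite_mul, zero_mul, sum_ite_eq, mem_range, Set.indicator, Set.mem_ofPred_eq]
    · intro c hc
      refine if_neg fun h => hc ?_
      obtain ⟨d, hd, hdc⟩ := c.exists_snoc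
      subst h
      exact ⟨⟨d, hd⟩, hdc⟩

theorem norm_chainTerm {r : ℕ} (k : Fin r → ℕ+) (z : Fin r → ℂ) (c : Chain r) :
    ‖chainTerm k z c‖ = chainTerm k (fun i => ‖z i‖) c := by
  simp [chainTerm, norm_prod]

theorem chainRow_nonneg {r : ℕ} (k : Fin r → ℕ+) (ρ : Fin r → ℝ) (hρ : ∀ i, 0 ≤ ρ i) (a : ℕ) :
    0 ≤ chainRow r k ρ a :=
  (hasSum_chainRow k ρ a).nonneg fun c => by
    split_ifs
    · exact prod_nonneg fun i _ => div_nonneg (pow_nonneg (hρ i) _) (by positivity)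
    · exact le_rfl

theorem last_pair_injective (r : ℕ) :
    Function.Injective fun c : Chain r => (c.last, c) := fun _ _ h => (Prod.ext_iff.1 h).2

theorem summable_norm_chainTerm {r : ℕ} {k : Fin r → ℕ+} {z : Fin r → ℂ}
    (h : Summable (chainRow r k fun i => ‖z i‖)) :
    Summable fun x : ℕ × Chain r => if x.2.last = x.1 then ‖chainTerm k z x.2‖ else 0 := by
  rw [summable_prod_of_nonneg fun x => by dsimp only [Pi.zero_apply]; positivity]
  have h1 : ∀ a, HasSum (fun c : Chain r => if c.last = a then ‖chainTerm k z c‖ else 0)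
      (chainRow r k (fun i => ‖z i‖) a) := by
    simpa only [norm_chainTerm] using hasSum_chainRow k fun i => ‖z i‖
  exact ⟨fun a => (h1 a).summable, h.congr fun a => (h1 a).tsum_eq.symm⟩

theorem summable_norm_liTerm {r : ℕ} {k : Fin r → ℕ+} {z : Fin r → ℂ}
    (h : Summable (chainRow r k fun i => ‖z i‖)) : Summable fun c : Chain r => ‖liTerm k z c‖ := by
  have := (summable_norm_chainTerm h).comp_injective (last_pair_injective r)
  simp only [Function.comp_def, if_true] at this
  exact this

/-- The family over pairs (a, c) is supported on a = c.last, so its sum is the sum over all chains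
as well as the iterated sum grouped by last entry. -/
theorem hasSum_chainRow_shuffleLi {r : ℕ} {k : Fin r → ℕ+} {z : Fin r → ℂ}
    (h : Summable (chainRow r k fun i => ‖z i‖)) : HasSum (chainRow r k z) (shuffleLi k z) := by
  have h1 : Summable fun x : ℕ × Chain r => if x.2.last = x.1 then chainTerm k z x.2 else 0 := by
    refine Summable.of_norm ((summable_norm_chainTerm h).congr fun x => ?_)
    split_ifs <;> simp
  obtain ⟨s, hs⟩ := h1
  have h2 : HasSum (liTerm k z) s := by
    rw [← (last_pair_injective r).hasSum_iff] at hs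
    · refine hs.congr_fun fun c => ?_
      simp only [Function.comp_apply, if_true]
      rfl
    · rintro ⟨a, c⟩ hx
      exact if_neg fun h => hx ⟨c, Prod.ext h rfl⟩
  rw [shuffleLi, h2.tsum_eq]
  exact hs.prod_fiberwise fun a => hasSum_chainRow k z a

/-- The real kernel of `e_z x^{k-1}` for `z = ρ`. -/
noncomputable def kerR (ρ : ℝ) (k : ℕ) (m a : ℕ) : ℝ :=
  if m < a then ρ ^ (a - m) / (a : ℝ) ^ k else 0

theorem kerR_nonneg {ρ : ℝ} (hρ : 0 ≤ ρ) (k m a : ℕ) : 0 ≤ kerR ρ k m a := by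
  unfold kerR; positivity

theorem kernelBound_kerR {ρ : ℝ} (hρ : 0 ≤ ρ) {k : ℕ} (hk : 1 ≤ k) : KernelBound ρ (kerR ρ k) := by
  refine Or.inr fun m a => ?_
  by_cases h : m < a
  · refine le_trans ?_ (rr_le_kup hρ h)
    rw [kerR, if_pos h, div_eq_mul_inv]
    refine mul_le_mul_of_nonneg_left ?_ (by positivity)
    have ha : (1 : ℝ) ≤ a := by exact_mod_cast (by omega : 1 ≤ a)
    rw [rr]
    refine inv_anti₀ (by linarith) ?_
    have := pow_le_pow_right₀ ha hk
    linarith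
  · rw [kerR, if_neg h]; exact kup_nonneg hρ m a

theorem chainRow_succ {r : ℕ} (k : Fin (r + 1) → ℕ+) (ρ : Fin (r + 1) → ℝ) (a : ℕ) :
    chainRow (r + 1) k ρ a = ∑ m ∈ range (a + 1),
      chainRow r (fun i => k i.castSucc) (fun i => ρ i.castSucc) m *
        kerR (ρ (Fin.last r)) (k (Fin.last r)) m a := by
  rw [sum_range_succ, chainRow, kerR, if_neg (lt_irrefl a), mul_zero, add_zero]
  refine sum_congr rfl fun m hm => ?_
  rw [kerR, if_pos (mem_range.1 hm)]

theorem exists_chainRow_le {r : ℕ} (k : Fin r → ℕ+) (ρ : Fin r → ℝ) (hρ : ∀ i, 0 ≤ ρ i)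
    (hρ1 : ∀ i, ρ i ≤ 1) : ∃ K, ∀ a, chainRow r k ρ a ≤ K * phi a := by
  induction r with
  | zero =>
    refine ⟨1, fun a => ?_⟩
    rw [chainRow, one_mul]
    split_ifs with h
    · rw [h, phi_zero]
    · exact (phi_pos a).le
  | succ r ih =>
    obtain ⟨K, hK⟩ := ih (fun i => k i.castSucc) (fun i => ρ i.castSucc) (fun i => hρ _)
      fun i => hρ1 _
    refine ⟨2 * K, fun a => ?_⟩
    rw [chainRow_succ]
    exact row_mul_le (chainRow_nonneg _ _ fun i => hρ _) hK
      ((kernelBound_kerR (hρ _) (PNat.pos _)).mono (hρ _) (hρ1 _)) a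

/-- The majorants for t = 1/4 also dominate t = 0. A last exponent at least 2 supplies the 1/a of
`summable_row_mul_div`; otherwise ρ < 1 and `summable_row_mul` applies. -/
theorem summable_chainRow {r : ℕ} (k : Fin r → ℕ+) (ρ : Fin r → ℝ) (hρ : ∀ i, 0 ≤ ρ i)
    (hρ1 : ∀ i, ρ i ≤ 1) (h : ∀ i : Fin r, i.1 + 1 = r → 2 ≤ (k i : ℕ) ∨ ρ i < 1) :
    Summable (chainRow r k ρ) := by
  cases r with
  | zero => exact summable_of_ne_finset_zero (s := {0}) fun a ha => if_neg (by simpa using ha)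
  | succ r =>
    obtain ⟨K, hK⟩ := exists_chainRow_le (fun i => k i.castSucc) (fun i => ρ i.castSucc)
      (fun i => hρ _) fun i => hρ1 _
    have h0 := chainRow_nonneg (fun i => k i.castSucc) (fun i => ρ i.castSucc) fun i => hρ _
    have hs : Summable fun x : ℕ × ℕ =>
        chainRow r (fun i => k i.castSucc) (fun i => ρ i.castSucc) x.1 *
          kerR (ρ (Fin.last r)) (k (Fin.last r)) x.1 x.2 := by
      rcases h (Fin.last r) (by simp) with h | h
      · have h1 := summable_row_mul_div h0 hK (kerR_nonneg (hρ (Fin.last r)) 1)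
          ((kernelBound_kerR (hρ _) le_rfl).mono (hρ _) (hρ1 _))
        refine Summable.of_nonneg_of_le (fun x => mul_nonneg (h0 _) (kerR_nonneg (hρ _) _ _ _))
          (fun x => ?_) h1
        rw [mul_div_assoc]
        refine mul_le_mul_of_nonneg_left ?_ (h0 _)
        rw [kerR, kerR]
        split_ifs with hx
        · have hx1 : (1 : ℝ) ≤ x.2 := by exact_mod_cast (by omega : 1 ≤ x.2)
          rw [div_div, pow_one, ← pow_two]
          have := pow_nonneg (hρ (Fin.last r)) (x.2 - x.1)
          gcongr
        · simp
      · exact summable_row_mul h0 hK (kerR_nonneg (hρ _) _) (hρ _) h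
          (kernelBound_kerR (hρ _) (PNat.pos _))
    refine hs.prod_symm.prod.congr fun a => ?_
    rw [chainRow_succ, tsum_eq_sum]
    · rfl
    · intro m hm
      have : ¬ m < a := by simp at hm; omega
      simp [kerR, this]

end Chains

/-! ### Spans of words -/

section Words

/-- The span of the words with a given property. -/
def wordSpan (P : List Letter → Prop) : Submodule ℚ Alg := Submodule.span ℚ (ofWord '' {w | P w})

variable {P Q : List Letter → Prop}

theorem ofWord_mem_wordSpan {w : List Letter} (h : P w) : ofWord w ∈ wordSpan P :=
  Submodule.subset_span ⟨w, h, rfl⟩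

/-- Words form a basis, so membership is a condition on the support. Conditions on first and last
letters can therefore be checked separately and then intersected. -/
theorem mem_wordSpan_iff {v : Alg} : v ∈ wordSpan P ↔
    ∀ w, (FreeAlgebra.basisFreeMonoid ℚ Letter).repr v (FreeMonoid.ofList w) ≠ 0 → P w := by
  have h : ofWord '' {w | P w} = FreeAlgebra.basisFreeMonoid ℚ Letter '' {w | P w.toList} := by
    ext v
    constructor
    · rintro ⟨w, hw, rfl⟩
      exact ⟨FreeMonoid.ofList w, hw, basisFreeMonoid_apply w⟩
    · rintro ⟨w, hw, rfl⟩
      exact ⟨w.toList, hw, (basisFreeMonoid_apply w.toList).symm⟩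
  rw [wordSpan, h, Module.Basis.mem_span_image]
  constructor
  · intro h w hw
    exact h (Finsupp.mem_support_iff.2 hw)
  · intro h w hw
    exact h w.toList (Finsupp.mem_support_iff.1 hw)

theorem mem_wordSpan_and {v : Alg} (hP : v ∈ wordSpan P) (hQ : v ∈ wordSpan Q) :
    v ∈ wordSpan fun w => P w ∧ Q w :=
  mem_wordSpan_iff.2 fun w hw => ⟨mem_wordSpan_iff.1 hP w hw, mem_wordSpan_iff.1 hQ w hw⟩

theorem wordSpan_mono (h : ∀ w, P w → Q w) : wordSpan P ≤ wordSpan Q :=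
  Submodule.span_mono (Set.image_mono h)

theorem ofWord_mem_wordSpan_iff {w : List Letter} : ofWord w ∈ wordSpan P ↔ P w := by
  refine ⟨fun h => mem_wordSpan_iff.1 h w ?_, ofWord_mem_wordSpan⟩
  rw [← basisFreeMonoid_apply, Module.Basis.repr_self, Finsupp.single_eq_same]
  exact one_ne_zero

theorem mem_wordSpan_true (v : Alg) : v ∈ wordSpan fun _ => True :=
  mem_wordSpan_iff.2 fun _ _ => trivial

theorem ofWord_append (u v : List Letter) : ofWord (u ++ v) = ofWord u * ofWord v := by
  simp [ofWord]

theorem ofWord_singleton_x : ofWord [Letter.x] = gx := by simp [ofWord, gx]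

theorem ofWord_singleton_e (z : BSet) : ofWord [Letter.e z] = ge z := by simp [ofWord, ge]

theorem wordSpan_mul_mem {v a : Alg} (h : ∀ u w, P u → P (u ++ w)) (hv : v ∈ wordSpan P) :
    v * a ∈ wordSpan P := by
  induction hv using Submodule.span_induction with
  | mem v hv =>
    obtain ⟨u, hu, rfl⟩ := hv
    induction mem_wordSpan_true a using Submodule.span_induction with
    | mem a ha =>
      obtain ⟨w, -, rfl⟩ := ha
      rw [← ofWord_append]
      exact ofWord_mem_wordSpan (h u w hu)
    | zero => rw [mul_zero]; exact zero_mem _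
    | add a b _ _ ha hb => rw [mul_add]; exact add_mem ha hb
    | smul c a _ ha => rw [mul_smul_comm]; exact Submodule.smul_mem _ _ ha
  | zero => rw [zero_mul]; exact zero_mem _
  | add v w _ _ hv hw => rw [add_mul]; exact add_mem hv hw
  | smul c v _ hv => rw [smul_mul_assoc]; exact Submodule.smul_mem _ _ hv

theorem mul_wordSpan_mem {v a : Alg} (h : ∀ u w, P u → P (w ++ u)) (hv : v ∈ wordSpan P) :
    a * v ∈ wordSpan P := by
  induction hv using Submodule.span_induction with
  | mem v hv =>
    obtain ⟨u, hu, rfl⟩ := hv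
    induction mem_wordSpan_true a using Submodule.span_induction with
    | mem a ha =>
      obtain ⟨w, -, rfl⟩ := ha
      rw [← ofWord_append]
      exact ofWord_mem_wordSpan (h u w hu)
    | zero => rw [zero_mul]; exact zero_mem _
    | add a b _ _ ha hb => rw [add_mul]; exact add_mem ha hb
    | smul c a _ ha => rw [smul_mul_assoc]; exact Submodule.smul_mem _ _ ha
  | zero => rw [mul_zero]; exact zero_mem _
  | add v w _ _ hv hw => rw [mul_add]; exact add_mem hv hw
  | smul c v _ hv => rw [mul_smul_comm]; exact Submodule.smul_mem _ _ hv

/-- The nonempty words with an admissible first letter. -/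
def StartsOK (w : List Letter) : Prop := ∃ l u, w = l :: u ∧ StartOK l

/-- The nonempty words with an admissible last letter. -/
def EndsOK (w : List Letter) : Prop := ∃ u l, w = u ++ [l] ∧ EndOK l

theorem StartsOK.append {u : List Letter} (h : StartsOK u) (w : List Letter) : StartsOK (u ++ w) := by
  obtain ⟨l, u, rfl, hl⟩ := h
  exact ⟨l, u ++ w, rfl, hl⟩

theorem EndsOK.append {u : List Letter} (h : EndsOK u) (w : List Letter) : EndsOK (w ++ u) := by
  obtain ⟨u, l, rfl, hl⟩ := h
  exact ⟨w ++ u, l, (List.append_assoc _ _ _).symm, hl⟩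

theorem startsOK_mul_mem {v : Alg} (a : Alg) (hv : v ∈ wordSpan StartsOK) :
    v * a ∈ wordSpan StartsOK := wordSpan_mul_mem (fun _ w h => h.append w) hv

theorem mul_endsOK_mem {v : Alg} (a : Alg) (hv : v ∈ wordSpan EndsOK) :
    a * v ∈ wordSpan EndsOK := mul_wordSpan_mem (fun _ w h => h.append w) hv

theorem ge_mem_startsOK {z : BSet} (hz : (z : ℂ).re ≠ 1 / 2) : ge z ∈ wordSpan StartsOK := by
  rw [← ofWord_singleton_e]
  exact ofWord_mem_wordSpan ⟨_, _, rfl, hz⟩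

theorem ge_mem_endsOK {z : BSet} (hz : ‖(z : ℂ)‖ ≠ 1) : ge z ∈ wordSpan EndsOK := by
  rw [← ofWord_singleton_e]
  exact ofWord_mem_wordSpan ⟨[], _, rfl, hz⟩

theorem gx_mem_endsOK : gx ∈ wordSpan EndsOK := by
  rw [← ofWord_singleton_x]
  exact ofWord_mem_wordSpan ⟨[], _, rfl, trivial⟩

theorem admissible_of_startsOK_endsOK {w : List Letter} (h : StartsOK w ∧ EndsOK w) :
    Admissible w := by
  obtain ⟨⟨l, u, rfl, hl⟩, ⟨v, l', h', hl'⟩⟩ := h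
  refine ⟨fun k hk => ?_, fun k hk => ?_⟩
  · simp only [List.head?_cons, Option.some.injEq] at hk
    exact hk ▸ hl
  · rw [h', List.getLast?_concat, Option.some.injEq] at hk
    exact hk ▸ hl'

theorem mem_wordSpan_admissible {v : Alg} (h : v ∈ wordSpan StartsOK) (h' : v ∈ wordSpan EndsOK) :
    v ∈ wordSpan Admissible :=
  wordSpan_mono (fun _ => admissible_of_startsOK_endsOK) (mem_wordSpan_and h h')

theorem Admissible.eq_nil_or {w : List Letter} (h : Admissible w) :
    w = [] ∨ StartsOK w ∧ EndsOK w := by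
  rcases List.eq_nil_or_concat' w with rfl | ⟨u, l, rfl⟩
  · exact Or.inl rfl
  · refine Or.inr ⟨?_, ⟨u, l, rfl, h.2 l (by simp)⟩⟩
    cases u with
    | nil => exact ⟨l, [], rfl, h.1 l rfl⟩
    | cons k u => exact ⟨k, u ++ [l], rfl, h.1 k rfl⟩

theorem one_mem_A0 : (1 : Alg) ∈ A0 :=
  Submodule.mem_sup_left (Submodule.mem_sup_left (Submodule.mem_sup_left
    (Submodule.subset_span rfl)))

/-- The four summands match four shapes of words: empty, a single letter, ending in `x`, and longer
words ending in some e_{z'}. -/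
theorem A0_eq : A0 = wordSpan Admissible := by
  refine le_antisymm (sup_le (sup_le (sup_le ?_ ?_) ?_) ?_) ?_
  · rw [Submodule.span_le]
    rintro _ rfl
    exact ofWord_mem_wordSpan (w := []) ⟨by simp, by simp⟩
  · rw [Submodule.span_le]
    rintro _ ⟨z, h1, h2, rfl⟩
    exact mem_wordSpan_admissible (ge_mem_startsOK h1) (ge_mem_endsOK h2)
  · rw [Submodule.span_le]
    rintro _ ⟨z, a, h1, rfl⟩
    exact mem_wordSpan_admissible (startsOK_mul_mem _ (startsOK_mul_mem _ (ge_mem_startsOK h1)))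
      (mul_endsOK_mem _ gx_mem_endsOK)
  · rw [Submodule.span_le]
    rintro _ ⟨z, z', a, h1, h2, rfl⟩
    exact mem_wordSpan_admissible (startsOK_mul_mem _ (startsOK_mul_mem _ (ge_mem_startsOK h1)))
      (mul_endsOK_mem _ (ge_mem_endsOK h2))
  · rw [wordSpan, Submodule.span_le]
    rintro _ ⟨w, hw, rfl⟩
    rcases Admissible.eq_nil_or hw with rfl | ⟨⟨l, u, rfl, hl⟩, -⟩
    · exact one_mem_A0
    · have hw2 := hw.2
      obtain _ | z := l
      · exact hl.elim
      rcases List.eq_nil_or_concat' u with rfl | ⟨u, l', rfl⟩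
      · rw [ofWord_singleton_e]
        exact Submodule.mem_sup_left (Submodule.mem_sup_left (Submodule.mem_sup_right
          (Submodule.subset_span ⟨z, hl, hw2 (Letter.e z) rfl, rfl⟩)))
      · have h2 : EndOK l' := hw2 l' (by rw [← List.cons_append, List.getLast?_concat])
        have h3 : ofWord (Letter.e z :: (u ++ [l'])) = ge z * ofWord u * ofWord [l'] := by
          rw [← ofWord_singleton_e, ← ofWord_append, ← ofWord_append]; simp
        rw [h3]
        obtain _ | z' := l'
        · rw [ofWord_singleton_x]
          exact Submodule.mem_sup_left (Submodule.mem_sup_right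
            (Submodule.subset_span ⟨z, _, hl, rfl⟩))
        · rw [ofWord_singleton_e]
          exact Submodule.mem_sup_right (Submodule.subset_span ⟨z, z', _, hl, h2, rfl⟩)

theorem mem_A0 {v : Alg} (h : v ∈ wordSpan StartsOK) (h' : v ∈ wordSpan EndsOK) : v ∈ A0 := by
  rw [A0_eq]; exact mem_wordSpan_admissible h h'

theorem ofWord_mem_A0_iff {w : List Letter} : ofWord w ∈ A0 ↔ Admissible w := by
  rw [A0_eq, ofWord_mem_wordSpan_iff]

end Words

/-! ### The evaluation of words -/

section Evaluation

theorem word_append (s s' : List (BSet × ℕ+)) : word (s ++ s') = word s ++ word s' := by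
  induction s with
  | nil => rfl
  | cons p s ih => simp [word, ih]

theorem replicate_append_word_scan (w : List Letter) :
    List.replicate (scan w).1 Letter.x ++ word (scan w).2 = w := by
  induction w with
  | nil => rfl
  | cons l w ih =>
    obtain _ | z := l
    · simp [scan, List.replicate_succ, ih]
    · simp [scan, word, ih]

theorem Admissible.exists_word {w : List Letter} (h : Admissible w) : ∃ s, w = word s := by
  rcases h.eq_nil_or with rfl | ⟨⟨l, u, rfl, hl⟩, -⟩
  · exact ⟨[], rfl⟩
  · obtain _ | z := l
    · exact hl.elim
    · exact ⟨_, (replicate_append_word_scan (Letter.e z :: u)).symm⟩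

theorem ofWord_word_singleton (p : BSet × ℕ+) :
    ofWord (word [p]) = ge p.1 * gx ^ ((p.2 : ℕ) - 1) := by
  simp [word, ofWord, ge, gx]

theorem rho_ofWord_word {r : ℕ} (f : Fin r → BSet × ℕ+) (a : ℕ) :
    rho (ofWord (word (List.ofFn f))) 0 a =
      chainRow r (fun i => (f i).2) (fun i => ((f i).1 : ℂ)) a := by
  induction r generalizing a with
  | zero => simp [word, ofWord, chainRow, eq_comm]
  | succ r ih =>
    have hk : ((f (Fin.last r)).2 : ℕ) - 1 + 1 = (f (Fin.last r)).2 :=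
      Nat.sub_add_cancel (PNat.pos _)
    rw [List.ofFn_succ', List.concat_eq_append, word_append, ofWord_append, ofWord_word_singleton,
      ← mul_assoc, rho_mul_gx_pow, map_mul, IncidenceAlgebra.mul_apply, chainRow,
      ← Nat.range_succ_eq_Icc_zero, sum_range_succ, rho_ge, if_neg (lt_irrefl a), mul_zero,
      add_zero, sum_div]
    refine sum_congr rfl fun m hm => ?_
    rw [ih, rho_ge, if_pos (mem_range.1 hm), mul_div_assoc, div_div, ← pow_succ', hk]

theorem rho_ofWord_word_eq (s : List (BSet × ℕ+)) :
    rho (ofWord (word s)) 0 = chainRow s.length (idx s) (arg s) := by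
  funext a
  have h := rho_ofWord_word s.get a
  rw [List.ofFn_get] at h
  exact h

theorem summable_chainRow_norm_arg {s : List (BSet × ℕ+)} (h : Admissible (word s)) :
    Summable (chainRow s.length (idx s) fun i => ‖arg s i‖) := by
  refine summable_chainRow _ _ (fun i => norm_nonneg _) (fun i => norm_le_one _) fun i hi => ?_
  rcases List.eq_nil_or_concat' s with rfl | ⟨u, p, rfl⟩
  · exact i.elim0
  have hp : (u ++ [p]).get i = p := by
    have : i.1 = u.length := by simpa using hi
    simp [this]
  rw [idx, arg, hp]
  by_contra hcon
  obtain ⟨hk, hz⟩ := not_or.1 hcon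
  -- With exponent 1 the word ends in e_z itself, and |z| = 1 is then excluded by admissibility.
  have hk1 : (p.2 : ℕ) - 1 = 0 := by omega
  refine h.2 (Letter.e p.1) ?_ (le_antisymm (norm_le_one _) (not_lt.1 hz))
  rw [word_append, word, hk1]
  simp [word]

/-- The extension of `L` to a linear map on `𝒜`. -/
noncomputable def LFull : Alg →ₗ[ℚ] ℂ :=
  (FreeAlgebra.basisFreeMonoid ℚ Letter).constr ℚ fun w : FreeMonoid Letter =>
    shuffleLi (idx (scan w.toList).2) (arg (scan w.toList).2)

theorem L0_eq_LFull {v : Alg} (h : v ∈ A0) : L0 ⟨v, h⟩ = LFull v := rfl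

theorem hasSum_rho_LFull {v : Alg} (h : v ∈ A0) : HasSum (rho v 0) (LFull v) := by
  rw [A0_eq] at h
  induction h using Submodule.span_induction with
  | mem v hv =>
    obtain ⟨w, hw, rfl⟩ := hv
    obtain ⟨s, rfl⟩ := Admissible.exists_word hw
    rw [← L0_eq_LFull (ofWord_mem_A0_iff.2 hw), L0_word, rho_ofWord_word_eq]
    exact hasSum_chainRow_shuffleLi (summable_chainRow_norm_arg hw)
  | zero => rw [map_zero rho, map_zero LFull]; exact hasSum_zero
  | add v w _ _ hv hw => rw [map_add, map_add]; exact hv.add hw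
  | smul c v _ hv => rw [map_smul, map_smul]; exact hv.const_smul c

end Evaluation

/-! ### The images of words under `σ` and `σ τ` -/

section Images

open PowerSeries (C)
open MulOpposite (unop)

/-- The power series all of whose coefficients lie in the span of the words with property `P`. -/
def CoeffsIn (P : List Letter → Prop) (f : Alg⟦X⟧) : Prop :=
  ∀ n, PowerSeries.coeff n f ∈ wordSpan P

theorem CoeffsIn.mul_right {f : Alg⟦X⟧} (h : CoeffsIn StartsOK f) (g : Alg⟦X⟧) :
    CoeffsIn StartsOK (f * g) := by
  intro n
  rw [PowerSeries.coeff_mul]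
  exact sum_mem fun p _ => startsOK_mul_mem _ (h _)

theorem CoeffsIn.mul_left {f : Alg⟦X⟧} (h : CoeffsIn EndsOK f) (g : Alg⟦X⟧) :
    CoeffsIn EndsOK (g * f) := by
  intro n
  rw [PowerSeries.coeff_mul]
  exact sum_mem fun p _ => mul_endsOK_mem _ (h _)

theorem CoeffsIn.add {P : List Letter → Prop} {f g : Alg⟦X⟧} (hf : CoeffsIn P f)
    (hg : CoeffsIn P g) : CoeffsIn P (f + g) := fun n => by
  rw [map_add]; exact add_mem (hf n) (hg n)

theorem CoeffsIn.neg {P : List Letter → Prop} {f : Alg⟦X⟧} (hf : CoeffsIn P f) :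
    CoeffsIn P (-f) := fun n => by
  rw [map_neg]; exact neg_mem (hf n)

theorem CoeffsIn.mul_X {P : List Letter → Prop} {f : Alg⟦X⟧} (hf : CoeffsIn P f) :
    CoeffsIn P (f * PowerSeries.X) := by
  rintro (_ | n)
  · simp
  · rw [PowerSeries.coeff_succ_mul_X]; exact hf n

theorem coeffsIn_C {P : List Letter → Prop} {v : Alg} (hv : v ∈ wordSpan P) :
    CoeffsIn P (C v) := by
  intro n
  rw [PowerSeries.coeff_C]
  split_ifs
  · exact hv
  · exact zero_mem _

theorem startsOK_ge_geom {z : BSet} (hz : (z : ℂ).re ≠ 1 / 2) :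
    CoeffsIn StartsOK (C (ge z) * geom gx) :=
  (coeffsIn_C (ge_mem_startsOK hz)).mul_right _

theorem endsOK_ge_geom {z : BSet} (hz : ‖(z : ℂ)‖ ≠ 1) : CoeffsIn EndsOK (C (ge z) * geom gx) := by
  intro n
  rw [PowerSeries.coeff_C_mul, geom, PowerSeries.coeff_mk]
  cases n with
  | zero => rw [pow_zero, mul_one]; exact ge_mem_endsOK hz
  | succ n => rw [pow_succ, ← mul_assoc]; exact mul_endsOK_mem _ gx_mem_endsOK

theorem startsOK_sigma {l : Letter} (h : StartOK l) :
    CoeffsIn StartsOK (sigma (C (FreeAlgebra.ι ℚ l))) := by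
  obtain _ | z := l
  · exact h.elim
  · exact (sigma_e z).symm ▸ startsOK_ge_geom h

theorem endsOK_sigma {l : Letter} (h : EndOK l) :
    CoeffsIn EndsOK (sigma (C (FreeAlgebra.ι ℚ l))) := by
  obtain _ | z := l
  · exact sigma_x.symm ▸ coeffsIn_C gx_mem_endsOK
  · exact (sigma_e z).symm ▸ endsOK_ge_geom h

/-- For z' = z/(z-1), Re z' = 1/2 means |z'| = |z' - 1|; as z' - 1 = 1/(z - 1), this says |z| = 1.
-/
theorem re_dualB_ne {z : BSet} (hz : z ≠ oneB) (h : ‖(z : ℂ)‖ ≠ 1) :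
    ((dualB z hz : BSet) : ℂ).re ≠ 1 / 2 := by
  intro h1
  have h2 : (z : ℂ) - 1 ≠ 0 := sub_ne_zero.2 fun h4 => hz (Subtype.ext h4)
  have h3 : ((dualB z hz : BSet) : ℂ) = z / (z - 1) := rfl
  have h4 : ((dualB z hz : BSet) : ℂ) - 1 = 1 / (z - 1) := by rw [h3]; field_simp; ring
  have h5 := (norm_le_norm_sub_one_iff _).2 h1.le
  have h6 : ‖1 - ((dualB z hz : BSet) : ℂ)‖ ≤ ‖1 - ((dualB z hz : BSet) : ℂ) - 1‖ := by
    rw [norm_le_norm_sub_one_iff, Complex.sub_re, h1]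
    norm_num
  rw [sub_sub_cancel_left, norm_neg, norm_sub_rev] at h6
  have h7 := le_antisymm h5 h6
  rw [h4, h3, norm_div, norm_div, div_left_inj' (norm_ne_zero_iff.2 h2), norm_one] at h7
  exact h h7

/-- The map z ↦ z/(z-1) exchanges the boundary lines Re z = 1/2 and |z| = 1, so τ exchanges the
conditions on first and last letters. -/
theorem startsOK_sigma_tau {l : Letter} (h : EndOK l) :
    CoeffsIn StartsOK (sigma (unop (tau (C (FreeAlgebra.ι ℚ l))))) := by
  obtain _ | z := l
  · have h1 : unop (tau (C (FreeAlgebra.ι ℚ Letter.x))) = C (ge oneB) := tau_x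
    rw [h1, sigma_e]
    exact startsOK_ge_geom (by norm_num [oneB])
  · have hz : z ≠ oneB := by
      rintro rfl
      exact h (by simp [oneB])
    have h1 : unop (tau (C (FreeAlgebra.ι ℚ (Letter.e z)))) =
      -(C (ge (dualB z hz)) * geom (ge (dualB z hz))) := tau_e z hz
    rw [h1, map_neg, map_mul, sigma_e]
    exact ((startsOK_ge_geom (re_dualB_ne hz h)).mul_right _).neg

theorem endsOK_sigma_tau {l : Letter} (h : StartOK l) :
    CoeffsIn EndsOK (sigma (unop (tau (C (FreeAlgebra.ι ℚ l))))) := by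
  obtain _ | z := l
  · exact h.elim
  by_cases hz : z = oneB
  · subst hz
    have h1 : unop (tau (C (FreeAlgebra.ι ℚ (Letter.e oneB)))) = C gx := tau_e_one
    rw [h1, sigma_x]
    exact coeffsIn_C gx_mem_endsOK
  · have h1 : unop (tau (C (FreeAlgebra.ι ℚ (Letter.e z)))) =
      -(C (ge (dualB z hz)) * geom (ge (dualB z hz))) := tau_e z hz
    have h2 := endsOK_ge_geom (z := dualB z hz) (norm_dualB_lt_one hz h).ne
    -- Unrolling the geometric series once leaves e_{z'}(1 - xt)⁻¹ as the rightmost non-central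
    -- factor of both terms.
    rw [h1, map_neg, sigma_ge_geom]
    exact (h2.add (h2.mul_left _).mul_X).neg

theorem one_mem_A0t : (1 : Alg⟦X⟧) ∈ A0t := by
  intro n
  rw [PowerSeries.coeff_one]
  split_ifs
  · exact one_mem_A0
  · exact zero_mem _

theorem ofWord_cons (l : Letter) (w : List Letter) :
    ofWord (l :: w) = FreeAlgebra.ι ℚ l * ofWord w := by simp [ofWord]

theorem ofWord_concat (l : Letter) (w : List Letter) :
    ofWord (w ++ [l]) = ofWord w * FreeAlgebra.ι ℚ l := by simp [ofWord]

theorem sigma_ofWord_mem {w : List Letter} (hw : Admissible w) : sigma (C (ofWord w)) ∈ A0t := by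
  rcases hw.eq_nil_or with rfl | ⟨⟨l, u, h, hl⟩, ⟨v, l', h', hl'⟩⟩
  · simpa [ofWord] using one_mem_A0t
  · refine fun n => mem_A0 ?_ ?_
    · rw [h, ofWord_cons, map_mul, map_mul]
      exact (startsOK_sigma hl).mul_right _ n
    · rw [h', ofWord_concat, map_mul, map_mul]
      exact (endsOK_sigma hl').mul_left _ n

theorem sigma_tau_ofWord_mem {w : List Letter} (hw : Admissible w) :
    sigma (unop (tau (C (ofWord w)))) ∈ A0t := by
  rcases hw.eq_nil_or with rfl | ⟨⟨l, u, h, hl⟩, ⟨v, l', h', hl'⟩⟩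
  · simpa [ofWord] using one_mem_A0t
  · refine fun n => mem_A0 ?_ ?_
    · rw [h', ofWord_concat, map_mul, map_mul, MulOpposite.unop_mul, map_mul]
      exact (startsOK_sigma_tau hl').mul_right _ n
    · rw [h, ofWord_cons, map_mul, map_mul, MulOpposite.unop_mul, map_mul]
      exact (endsOK_sigma_tau hl).mul_left _ n

theorem LFull_coeff_eq_tsum {f : Alg⟦X⟧} (hf : f ∈ A0t) (n : ℕ) :
    LFull (PowerSeries.coeff n f) = PowerSeries.coeff n (∑' a, ker f 0 a) := by
  have h : HasSum (ker f 0) (PowerSeries.mk fun n => LFull (PowerSeries.coeff n f)) := by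
    rw [PowerSeries.WithPiTopology.hasSum_iff_hasSum_coeff]
    intro d
    rw [PowerSeries.coeff_mk]
    simp only [coeff_ker]
    exact hasSum_rho_LFull (hf d)
  rw [h.tsum_eq, PowerSeries.coeff_mk]

theorem LFull_coeff_sigma_ofWord {w : List Letter} (hw : Admissible w) (n : ℕ) :
    LFull (PowerSeries.coeff n (sigma (C (ofWord w)))) =
      LFull (PowerSeries.coeff n (sigma (unop (tau (C (ofWord w)))))) := by
  rw [LFull_coeff_eq_tsum (sigma_ofWord_mem hw), LFull_coeff_eq_tsum (sigma_tau_ofWord_mem hw)]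
  exact congrArg _ (tsum_rowS_eq_tsum_rowST hw)

/-! ### Linear extension from words to power series -/

theorem coeff_L (f : A0t) (n : ℕ) :
    PowerSeries.coeff n (L f) = LFull (PowerSeries.coeff n f.1) :=
  PowerSeries.coeff_mk n fun n => LFull (PowerSeries.coeff n f.1)

theorem extend_mem_A0t {φ : Alg →ₗ[ℚ] Alg⟦X⟧} (h : ∀ w, Admissible w → φ (ofWord w) ∈ A0t)
    {f : Alg⟦X⟧} (hf : f ∈ A0t) : extend φ f ∈ A0t := by
  intro n
  rw [coeff_extend]
  refine sum_mem fun p _ => ?_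
  have h1 : ∀ v ∈ A0, φ v ∈ A0t := by
    intro v hv
    rw [A0_eq] at hv
    induction hv using Submodule.span_induction with
    | mem v hv => obtain ⟨w, hw, rfl⟩ := hv; exact h w hw
    | zero => rw [map_zero]; exact zero_mem _
    | add v w _ _ hv hw => rw [map_add]; exact add_mem hv hw
    | smul c v _ hv => rw [map_smul]; exact A0t.smul_mem c hv
  exact h1 _ (hf p.1) p.2

theorem LFull_coeff_extend {φ ψ : Alg →ₗ[ℚ] Alg⟦X⟧}
    (h : ∀ w, Admissible w → ∀ n, LFull (PowerSeries.coeff n (φ (ofWord w))) =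
      LFull (PowerSeries.coeff n (ψ (ofWord w)))) {f : Alg⟦X⟧} (hf : f ∈ A0t) (n : ℕ) :
    LFull (PowerSeries.coeff n (extend φ f)) = LFull (PowerSeries.coeff n (extend ψ f)) := by
  have h1 : ∀ v ∈ A0, ∀ n, LFull (PowerSeries.coeff n (φ v)) =
      LFull (PowerSeries.coeff n (ψ v)) := by
    intro v hv
    rw [A0_eq] at hv
    have hc : ∀ (n : ℕ) (c : ℚ) (g : Alg⟦X⟧),
      PowerSeries.coeff n (c • g) = c • PowerSeries.coeff n g := fun _ _ _ => rfl
    induction hv using Submodule.span_induction with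
    | mem v hv => obtain ⟨w, hw, rfl⟩ := hv; exact h w hw
    | zero => simp
    | add v w _ _ hv hw => intro n; simp only [map_add, hv n, hw n]
    | smul c v _ hv => intro n; rw [map_smul φ, map_smul ψ, hc, hc, map_smul LFull, map_smul LFull, hv n]
  rw [coeff_extend, coeff_extend, map_sum, map_sum]
  exact sum_congr rfl fun p _ => h1 _ (hf p.1) p.2

/-- The restriction of `σ` to `𝒜`. -/
noncomputable def sigmaLin : Alg →ₗ[ℚ] Alg⟦X⟧ := (FreeAlgebra.lift ℚ sigmaGen).toLinearMap

theorem sigma_eq_extend (f : Alg⟦X⟧) : sigma f = extend sigmaLin f := rfl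

theorem sigmaLin_apply (v : Alg) : sigmaLin v = sigma (C v) := by
  rw [sigma_eq_extend, extend_C]

theorem sigma_tau_eq_extend (f : Alg⟦X⟧) :
    sigma (unop (tau f)) = extend (extend sigmaLin ∘ₗ tauLin) f :=
  extend_extend sigmaLin tauLin f

theorem sigma_tau_lin_apply (v : Alg) :
    (extend sigmaLin ∘ₗ tauLin) v = sigma (unop (tau (C v))) := by
  rw [sigma_tau_eq_extend, extend_C]

end Images

end HoffmanMPL

/-! ### Absolute convergence and the duality -/

theorem mainTheorem6 :
    (∀ s : List (HoffmanMPL.BSet × ℕ+),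
      HoffmanMPL.ofWord (HoffmanMPL.word s) ∈ HoffmanMPL.A0 →
        Summable fun m : HoffmanMPL.Chain s.length =>
          ‖HoffmanMPL.liTerm (HoffmanMPL.idx s) (HoffmanMPL.arg s) m‖) ∧
    ∀ w : PowerSeries HoffmanMPL.Alg, w ∈ HoffmanMPL.A0t →
      ∃ (h₁ : HoffmanMPL.sigma w ∈ HoffmanMPL.A0t)
        (h₂ : HoffmanMPL.sigma (MulOpposite.unop (HoffmanMPL.tau w)) ∈ HoffmanMPL.A0t),
        HoffmanMPL.L ⟨HoffmanMPL.sigma w, h₁⟩ =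
          HoffmanMPL.L ⟨HoffmanMPL.sigma (MulOpposite.unop (HoffmanMPL.tau w)), h₂⟩ := by
  refine ⟨fun s hs => HoffmanMPL.summable_norm_liTerm
    (HoffmanMPL.summable_chainRow_norm_arg (HoffmanMPL.ofWord_mem_A0_iff.1 hs)), fun w hw => ?_⟩
  have h₁ : HoffmanMPL.sigma w ∈ HoffmanMPL.A0t := by
    rw [HoffmanMPL.sigma_eq_extend]
    refine HoffmanMPL.extend_mem_A0t (fun u hu => ?_) hw
    rw [HoffmanMPL.sigmaLin_apply]
    exact HoffmanMPL.sigma_ofWord_mem hu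
  have h₂ : HoffmanMPL.sigma (MulOpposite.unop (HoffmanMPL.tau w)) ∈ HoffmanMPL.A0t := by
    rw [HoffmanMPL.sigma_tau_eq_extend]
    refine HoffmanMPL.extend_mem_A0t (fun u hu => ?_) hw
    rw [HoffmanMPL.sigma_tau_lin_apply]
    exact HoffmanMPL.sigma_tau_ofWord_mem hu
  refine ⟨h₁, h₂, ?_⟩
  ext n
  have h := HoffmanMPL.LFull_coeff_extend (φ := HoffmanMPL.sigmaLin)
    (ψ := HoffmanMPL.extend HoffmanMPL.sigmaLin ∘ₗ HoffmanMPL.tauLin) (fun u hu n => by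
      rw [HoffmanMPL.sigmaLin_apply, HoffmanMPL.sigma_tau_lin_apply]
      exact HoffmanMPL.LFull_coeff_sigma_ofWord hu n) hw n
  rw [← HoffmanMPL.sigma_eq_extend, ← HoffmanMPL.sigma_tau_eq_extend] at h
  rw [HoffmanMPL.coeff_L, HoffmanMPL.coeff_L, h]
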